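/- Throughout, $k$ is a field and all algebras are associative and unital; "noetherian" means left and right noetherian. Definitions. An $\mathbb N$-filtration $\mathcal F$ of an algebra $A$ over a commutative ring $R$ is an ascending chain of $R$-submodules $\mathcal F_0\subseteq\mathcal F_1\subseteq\cdots$ with $1\in\mathcal F_0$, $\mathcal F_i\mathcal F_j\subseteq\mathcal F_{i+j}$ and $\bigcup_n\mathcal F_n=A$; it is locally finite if every $\mathcal F_n$ is a finitely generated $R$-module, and $\operatorname{gr}_{\mathcal F}A=\bigoplus_n\mathcal F_n/\mathcal F_{n-1}$ (with $\mathcal F_{-1}=0$); a graded $R$-algebra is locally finite if each of its components is a finitely generated $R$-module. If $D\subseteq k$ is a subring, an order of a $k$-algebra $A$ over $D$ is a $D$-subalgebra $A_D\subseteq A$ that is free as a $D$-module and for which the multiplication map $A_D\otimes_D k\to A$ is bijective. An $R$-algebra $B$ is strongly noetherian (respectively universally noetherian) over $R$ if $B\otimes_R C$ is noetherian for every commutative noetherian $R$-algebra $C$ (respectively for every noetherian $R$-algebra $C$, commutative or not). A $k$-algebra $A$ with an $\mathbb N$-filtration $\mathcal F$ is congenial if $\mathcal F$ is locally finite and there are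 a subring $D\subseteq k$, finitely generated as a ring, and an order $A_D$ of $A$ over $D$ such that 1. the induced filtration $(\mathcal F_n\cap A_D)_n$ of the $D$-algebra $A_D$ is locally finite; 2. $\operatorname{gr}A_D$, formed with the induced filtration and mapped canonically and injectively to $\operatorname{gr}_{\mathcal F}A$, is an order of $\operatorname{gr}_{\mathcal F}A$ over $D$; 3. $\operatorname{gr}A_D$ is a strongly noetherian locally finite graded $D$-algebra; 4. for every factor ring $F$ of $D$ that is a finite field, $A_D\otimes_D F$ is a finitely generated noetherian $F$-algebra that satisfies a nonzero polynomial identity over $F$. Theorem. Let $A_1$ and $A_2$ be $k$-algebras that are congenial with respect to $\mathbb N$-filtrations $\mathcal F_1$ and $\mathcal F_2$. Suppose that the congeniality of $A_1$ is witnessed by a subring $D_1\subseteq k$ and an order $(A_1)_{D_1}$ for which $\operatorname{gr}\,(A_1)_{D_1}$ is universally noetherian over $D_1$. Then $A_1\otimes_k A_2$ is congenial with respect to the tensor-sum filtration $\mathcal F$, where $\mathcal F_n$ is the $k$-span of all $a_1\otimes a_2$ with $a_1\in(\mathcal F_1)_r$, $a_2\in(\mathcal F_2)_s$ and $r+s\le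 n$. -/

import Mathlib

open scoped DirectSum TensorProduct

universe u

/-- An `ℕ`-filtration of the `R`-algebra `A`: an exhaustive ascending chain
`F 0 ≤ F 1 ≤ ⋯` of `R`-submodules with `1 ∈ F 0` and `F i * F j ≤ F (i + j)`. -/
structure AlgFiltration (R : Type*) (A : Type*) [CommRing R] [Ring A] [Algebra R A] where
  toFun : ℕ → Submodule R A
  mono' : Monotone toFun
  one_mem' : (1 : A) ∈ toFun 0
  mul_mem' : ∀ {i j : ℕ} {a b : A}, a ∈ toFun i → b ∈ toFun j → a * b ∈ toFun (i + j)
  exhaustive' : ∀ a : A, ∃ n, a ∈ toFun n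

namespace AlgFiltration

section Gr

variable {R A : Type*} [CommRing R] [Ring A] [Algebra R A] (F : AlgFiltration R A)

/-- The previous layer `F (n - 1)`, with `F (-1) = 0`. -/
def pred : ℕ → Submodule R A
  | 0 => ⊥
  | n + 1 => F.toFun n

theorem mul_mem_pred_left {i j : ℕ} {a b : A} (ha : a ∈ F.pred i) (hb : b ∈ F.toFun j) :
    a * b ∈ F.pred (i + j) := by
  cases i with
  | zero =>
    have h0 : a = 0 := by simpa [pred] using ha
    simp [h0]
  | succ i =>
    have h := F.mul_mem' (i := i) ha hb
    rw [Nat.succ_add]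
    exact h

theorem mul_mem_pred_right {i j : ℕ} {a b : A} (ha : a ∈ F.toFun i) (hb : b ∈ F.pred j) :
    a * b ∈ F.pred (i + j) := by
  cases j with
  | zero =>
    have h0 : b = 0 := by simpa [pred] using hb
    simp [h0]
  | succ j => exact F.mul_mem' (j := j) ha hb

/-- The component `F n / F (n - 1)` of the associated graded algebra. -/
def GrPiece (n : ℕ) : Type _ := ↥(F.toFun n) ⧸ (F.pred n).submoduleOf (F.toFun n)

instance instGrPieceAddCommGroup (n : ℕ) : AddCommGroup (F.GrPiece n) :=
  inferInstanceAs (AddCommGroup (↥(F.toFun n) ⧸ (F.pred n).submoduleOf (F.toFun n)))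

/-- `F n / F (n - 1)` is a module over `R`, and over every commutative ring `S` over which `R`
and `A` are compatibly algebras. -/
instance instGrPieceModule {S : Type*} [CommRing S] [Algebra S R] [Algebra S A]
    [IsScalarTower S R A] (n : ℕ) : Module S (F.GrPiece n) :=
  Submodule.Quotient.module' ((F.pred n).submoduleOf (F.toFun n))

instance instGrPieceIsScalarTower {S : Type*} [CommRing S] [Algebra S R] [Algebra S A]
    [IsScalarTower S R A] (n : ℕ) : IsScalarTower S R (F.GrPiece n) where
  smul_assoc s r x := by
    obtain ⟨x, rfl⟩ := Submodule.Quotient.mk_surjective _ x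
    exact congrArg (Submodule.Quotient.mk (p := (F.pred n).submoduleOf (F.toFun n)))
      (smul_assoc s r x)

/-- The quotient map `F n → F n / F (n - 1)`. -/
def grMk (n : ℕ) : F.toFun n →ₗ[R] F.GrPiece n where
  toFun x := Submodule.Quotient.mk (p := (F.pred n).submoduleOf (F.toFun n)) x
  map_add' _ _ := rfl
  map_smul' _ _ := rfl

theorem grMk_surjective (n : ℕ) : Function.Surjective (F.grMk n) :=
  Submodule.Quotient.mk_surjective _

theorem grMk_eq_zero {n : ℕ} {x : F.toFun n} (hx : (x : A) ∈ F.pred n) : F.grMk n x = 0 :=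
  (Submodule.Quotient.mk_eq_zero _).2 hx

theorem grMk_heq {i j : ℕ} (h : i = j) (x : F.toFun i) (y : F.toFun j) (hxy : (x : A) = y) :
    GradedMonoid.mk (A := F.GrPiece) i (F.grMk i x) = GradedMonoid.mk j (F.grMk j y) := by
  subst h
  have hx : x = y := Subtype.ext hxy
  rw [hx]

/-- Multiplication `F i × F j → F (i + j)`. -/
def layerMul (i j : ℕ) : F.toFun i →ₗ[R] F.toFun j →ₗ[R] F.toFun (i + j) :=
  LinearMap.mk₂ R (fun a b => ⟨(a : A) * b, F.mul_mem' a.2 b.2⟩)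
    (fun a a' b => Subtype.ext (add_mul (a : A) a' b))
    (fun c a b => Subtype.ext (smul_mul_assoc c (a : A) b))
    (fun a b b' => Subtype.ext (mul_add (a : A) b b'))
    (fun c a b => Subtype.ext (mul_smul_comm c (a : A) b))

/-- The linear map out of `F n / F (n - 1)` induced by a linear map that kills `F (n - 1)`. -/
def grLift {M : Type*} [AddCommGroup M] [Module R M] {n : ℕ} (g : F.toFun n →ₗ[R] M)
    (hg : ∀ x : F.toFun n, (x : A) ∈ F.pred n → g x = 0) : F.GrPiece n →ₗ[R] M :=
  Submodule.liftQ ((F.pred n).submoduleOf (F.toFun n)) g hg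

/-- The product of the classes of `a` and `b` is the class of `a * b`. -/
def grMul (i j : ℕ) : F.GrPiece i →ₗ[R] F.GrPiece j →ₗ[R] F.GrPiece (i + j) :=
  F.grLift
    (LinearMap.flip (F.grLift
      (LinearMap.flip ((F.layerMul i j).compr₂ (F.grMk (i + j))))
      (fun _ hb => LinearMap.ext fun a => F.grMk_eq_zero (F.mul_mem_pred_right a.2 hb))))
    (fun a ha => LinearMap.ext fun b => by
      obtain ⟨b, rfl⟩ := F.grMk_surjective _ b
      exact F.grMk_eq_zero (F.mul_mem_pred_left ha b.2))

theorem grMul_mk {i j : ℕ} (a : F.toFun i) (b : F.toFun j) :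
    F.grMul i j (F.grMk i a) (F.grMk j b) =
      F.grMk (i + j) ⟨(a : A) * b, F.mul_mem' a.2 b.2⟩ := rfl

instance instGOne : GradedMonoid.GOne F.GrPiece where
  one := F.grMk 0 ⟨1, F.one_mem'⟩

instance instGMul : GradedMonoid.GMul F.GrPiece where
  mul {i j} a b := F.grMul i j a b

instance instGRing : DirectSum.GRing F.GrPiece where
  mul_zero a := map_zero (F.grMul _ _ a)
  zero_mul b := by
    change F.grMul _ _ 0 b = 0
    simp
  mul_add a b c := map_add (F.grMul _ _ a) b c
  add_mul a b c := by
    change F.grMul _ _ (a + b) c = F.grMul _ _ a c + F.grMul _ _ b c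
    simp
  one_mul := by
    rintro ⟨i, a⟩
    obtain ⟨a, rfl⟩ := F.grMk_surjective _ a
    exact F.grMk_heq (zero_add i) _ _ (one_mul (a : A))
  mul_one := by
    rintro ⟨i, a⟩
    obtain ⟨a, rfl⟩ := F.grMk_surjective _ a
    exact F.grMk_heq (add_zero i) _ _ (mul_one (a : A))
  mul_assoc := by
    rintro ⟨i, a⟩ ⟨j, b⟩ ⟨l, c⟩
    obtain ⟨a, rfl⟩ := F.grMk_surjective _ a
    obtain ⟨b, rfl⟩ := F.grMk_surjective _ b
    obtain ⟨c, rfl⟩ := F.grMk_surjective _ c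
    exact F.grMk_heq (add_assoc i j l) _ _ (mul_assoc (a : A) b c)
  natCast n := n • F.grMk 0 ⟨1, F.one_mem'⟩
  natCast_zero := zero_smul _ _
  natCast_succ n := succ_nsmul _ n
  intCast n := n • F.grMk 0 ⟨1, F.one_mem'⟩
  intCast_ofNat n := natCast_zsmul _ n
  intCast_negSucc_ofNat n := negSucc_zsmul _ n

/-- The associated graded algebra `⨁ n, F n / F (n - 1)`. -/
def Gr : Type _ := ⨁ n, F.GrPiece n

instance instGrRing : Ring F.Gr := DirectSum.ring F.GrPiece

section Scalars

variable {S : Type*} [CommRing S] [Algebra S R] [Algebra S A] [IsScalarTower S R A]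

/-- The associated graded algebra is an algebra over `R`, and also over every commutative ring
`S` over which `R` and `A` are compatibly algebras. -/
instance instGAlgebra : DirectSum.GAlgebra S F.GrPiece where
  toFun :=
    { toFun := fun s => s • F.grMk 0 ⟨1, F.one_mem'⟩
      map_zero' := zero_smul _ _
      map_add' := fun s t => add_smul s t _ }
  map_one := one_smul _ _
  map_mul r s := by
    refine F.grMk_heq (zero_add 0).symm ((r * s) • (⟨1, F.one_mem'⟩ : F.toFun 0))
      ⟨(r • (1 : A)) * (s • (1 : A)), _⟩ ?_
    change (r * s) • (1 : A) = (r • (1 : A)) * (s • (1 : A))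
    rw [smul_mul_smul_comm, mul_one]
  commutes r := by
    rintro ⟨i, a⟩
    obtain ⟨a, rfl⟩ := F.grMk_surjective _ a
    refine F.grMk_heq (add_comm 0 i) ⟨(r • (1 : A)) * a, _⟩ ⟨(a : A) * (r • (1 : A)), _⟩ ?_
    simp
  smul_def r := by
    rintro ⟨i, a⟩
    obtain ⟨a, rfl⟩ := F.grMk_surjective _ a
    refine F.grMk_heq (zero_add i).symm (r • a) ⟨(r • (1 : A)) * a, _⟩ ?_
    change r • (a : A) = (r • (1 : A)) * a
    simp

instance instGrAlgebra : Algebra S F.Gr :=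
  inferInstanceAs (Algebra S (⨁ n, F.GrPiece n))

instance instGrIsScalarTower : IsScalarTower S R F.Gr :=
  inferInstanceAs (IsScalarTower S R (⨁ n, F.GrPiece n))

end Scalars

/-- Every layer of the filtration is a finitely generated module. -/
def LocallyFinite : Prop := ∀ n, Module.Finite R (F.toFun n)

/-- Every component of the associated graded algebra is a finitely generated module. -/
def GrLocallyFinite : Prop := ∀ n, Module.Finite R (F.GrPiece n)

end Gr

section Induced

variable {R A : Type*} [CommRing R] [Ring A] [Algebra R A] (F : AlgFiltration R A)
variable {S : Type*} [CommRing S] [Algebra S R] [Algebra S A] [IsScalarTower S R A]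

/-- The filtration `F n ∩ B` induced on an `S`-subalgebra `B` of `A`. -/
def induced (B : Subalgebra S A) : AlgFiltration S B where
  toFun n := ((F.toFun n).restrictScalars S).comap B.val.toLinearMap
  mono' _ _ h _ hx := F.mono' h hx
  one_mem' := F.one_mem'
  mul_mem' ha hb := F.mul_mem' ha hb
  exhaustive' b := F.exhaustive' (b : A)

theorem induced_pred_val (B : Subalgebra S A) {n : ℕ} {b : B}
    (hb : b ∈ (F.induced B).pred n) : (b : A) ∈ F.pred n := by
  cases n with
  | zero =>
    have h0 : b = 0 := by simpa [pred] using hb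
    simp [h0]
  | succ n => exact hb

/-- The inclusion `F n ∩ B → F n`. -/
def layerIncl (B : Subalgebra S A) (n : ℕ) : (F.induced B).toFun n →ₗ[S] F.toFun n where
  toFun b := ⟨((b : B) : A), b.2⟩
  map_add' _ _ := rfl
  map_smul' _ _ := rfl

/-- The map `(F n ∩ B) / (F (n - 1) ∩ B) → F n / F (n - 1)` induced by the inclusion. -/
def grPieceIncl (B : Subalgebra S A) (n : ℕ) : (F.induced B).GrPiece n →ₗ[S] F.GrPiece n :=
  (F.induced B).grLift (((F.grMk n).restrictScalars S).comp (F.layerIncl B n))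
    (fun _ hb => F.grMk_eq_zero (F.induced_pred_val B hb))

theorem grPieceIncl_mk (B : Subalgebra S A) (n : ℕ) (b : (F.induced B).toFun n) :
    F.grPieceIncl B n ((F.induced B).grMk n b) = F.grMk n ⟨((b : B) : A), b.2⟩ := rfl

/-- The canonical homomorphism `gr B → gr A` for an `S`-subalgebra `B` of `A` with the induced
filtration. -/
noncomputable def grIncl (B : Subalgebra S A) : (F.induced B).Gr →ₐ[S] F.Gr :=
  DirectSum.toAlgebra S (F.induced B).GrPiece
    (fun n => (DirectSum.lof S ℕ F.GrPiece n).comp (F.grPieceIncl B n))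
    rfl
    (by
      intro i j a b
      obtain ⟨a, rfl⟩ := (F.induced B).grMk_surjective _ a
      obtain ⟨b, rfl⟩ := (F.induced B).grMk_surjective _ b
      exact (DirectSum.of_mul_of (A := F.GrPiece)
        (F.grPieceIncl B i ((F.induced B).grMk i a))
        (F.grPieceIncl B j ((F.induced B).grMk j b))).symm)

end Induced

section Tensor

variable {k A₁ A₂ : Type*} [CommRing k] [Ring A₁] [Ring A₂] [Algebra k A₁] [Algebra k A₂]

/-- The tensor-sum filtration on `A₁ ⊗ A₂`: its `n`-th layer is spanned by the tensors `a ⊗ b`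
with `a ∈ F₁ r`, `b ∈ F₂ s` and `r + s ≤ n`. -/
def tensor (F₁ : AlgFiltration k A₁) (F₂ : AlgFiltration k A₂) :
    AlgFiltration k (A₁ ⊗[k] A₂) where
  toFun n := Submodule.span k
    {t | ∃ r s : ℕ, r + s ≤ n ∧ ∃ a ∈ F₁.toFun r, ∃ b ∈ F₂.toFun s, a ⊗ₜ[k] b = t}
  mono' := by
    intro m n hmn
    refine Submodule.span_mono ?_
    rintro t ⟨r, s, hrs, h⟩
    exact ⟨r, s, hrs.trans hmn, h⟩
  one_mem' := Submodule.subset_span ⟨0, 0, le_rfl, 1, F₁.one_mem', 1, F₂.one_mem', rfl⟩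
  mul_mem' := by
    intro i j x y hx hy
    have h := Submodule.mul_mem_mul hx hy
    rw [Submodule.span_mul_span] at h
    refine Submodule.span_mono ?_ h
    rintro _ ⟨_, ⟨r, s, hrs, a, ha, b, hb, rfl⟩, _, ⟨r', s', hrs', a', ha', b', hb', rfl⟩, rfl⟩
    exact ⟨r + r', s + s', by omega, a * a', F₁.mul_mem' ha ha', b * b', F₂.mul_mem' hb hb',
      (Algebra.TensorProduct.tmul_mul_tmul a a' b b').symm⟩
  exhaustive' := by
    intro x
    induction x using TensorProduct.induction_on with
    | zero => exact ⟨0, Submodule.zero_mem _⟩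
    | tmul a b =>
      obtain ⟨r, hr⟩ := F₁.exhaustive' a
      obtain ⟨s, hs⟩ := F₂.exhaustive' b
      exact ⟨r + s, Submodule.subset_span ⟨r, s, le_rfl, a, hr, b, hs, rfl⟩⟩
    | add x y hx hy =>
      obtain ⟨m, hm⟩ := hx
      obtain ⟨n, hn⟩ := hy
      refine ⟨max m n, Submodule.add_mem _ ?_ ?_⟩
      · refine Submodule.span_mono ?_ hm
        rintro t ⟨r, s, hrs, h⟩
        exact ⟨r, s, hrs.trans (le_max_left m n), h⟩
      · refine Submodule.span_mono ?_ hn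
        rintro t ⟨r, s, hrs, h⟩
        exact ⟨r, s, hrs.trans (le_max_right m n), h⟩

end Tensor

end AlgFiltration

/-- A (not necessarily commutative) ring that is left and right noetherian. -/
structure IsNoethRing (A : Type*) [Ring A] : Prop where
  left : IsNoetherianRing A
  right : IsNoetherianRing Aᵐᵒᵖ

/-- `A ⊗_R C` is noetherian for every commutative noetherian `R`-algebra `C`. -/
def IsStronglyNoetherian (R A : Type u) [CommRing R] [Ring A] [Algebra R A] : Prop :=
  ∀ (C : Type u) [CommRing C] [Algebra R C], IsNoetherianRing C → IsNoethRing (A ⊗[R] C)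

/-- `A ⊗_R C` is noetherian for every noetherian `R`-algebra `C`, commutative or not. -/
def IsUniversallyNoetherian (R A : Type u) [CommRing R] [Ring A] [Algebra R A] : Prop :=
  ∀ (C : Type u) [Ring C] [Algebra R C], IsNoethRing C → IsNoethRing (A ⊗[R] C)

/-- A polynomial identity algebra over a field `K`: some nonzero noncommutative polynomial over
`K` vanishes under every substitution of elements of `A` for its variables. -/
def IsPIAlgebra (K A : Type*) [Field K] [Ring A] [Algebra K A] : Prop :=
  ∃ f : FreeAlgebra K ℕ, f ≠ 0 ∧ ∀ x : ℕ → A, FreeAlgebra.lift K x f = 0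

/-- The `D`-algebra `B`, regarded as a `D`-subalgebra of the `k`-algebra `A` through the injective
homomorphism `f`, is an order of `A`: it is free over `D`, and the multiplication map
`k ⊗_D B → A` is bijective. -/
structure IsOrder (k : Type*) {D A B : Type*} [CommRing k] [CommRing D] [Algebra D k] [Ring A]
    [Algebra k A] [Algebra D A] [IsScalarTower D k A] [Ring B] [Algebra D B]
    (f : B →ₐ[D] A) : Prop where
  injective : Function.Injective f
  free : Module.Free D B
  baseChange : IsBaseChange k f.toLinearMap

namespace AlgFiltration

variable {k A : Type u} [Field k] [Ring A] [Algebra k A]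

/-- The filtered algebra `A` is congenial, as witnessed by the finitely generated subring `D` of
`k` and the `D`-subalgebra `B` of `A`. In `reduction`, `K` is a finite field that is a factor
ring of `D`. -/
structure IsCongenialWith (F : AlgFiltration k A) (D : Subalgebra ℤ k)
    (B : Subalgebra D A) : Prop where
  affine : D.FG
  locallyFinite : F.LocallyFinite
  order : IsOrder k B.val
  order_locallyFinite : (F.induced B).LocallyFinite
  gr_order : IsOrder k (F.grIncl B)
  gr_stronglyNoetherian : IsStronglyNoetherian D (F.induced B).Gr
  gr_locallyFinite : (F.induced B).GrLocallyFinite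
  reduction : ∀ (K : Type u) [Field K] [Finite K] [Algebra D K],
    Function.Surjective (algebraMap D K) →
      Algebra.FiniteType K (K ⊗[D] B) ∧ IsNoethRing (K ⊗[D] B) ∧ IsPIAlgebra K (K ⊗[D] B)

/-- The `k`-algebra `A` is congenial with respect to the filtration `F`. -/
def IsCongenial (F : AlgFiltration k A) : Prop :=
  ∃ (D : Subalgebra ℤ k) (B : Subalgebra D A), F.IsCongenialWith D B

end AlgFiltration

/-! Let `D` be the subring of `k` generated by `D₁` and `D₂`, and let `B` be the `D`-span of the
products of elements of the two orders. Then `B` carries two filtrations: the induced one, and the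
product filtration `M` built from the filtrations of the two orders. The crux is that they agree
(`IsProduct.induced`). Over the field `k`, gr of the tensor product is the tensor product of the
gr's (`IsProduct.bijective_gr`). As gr of `M` is spanned over `D` by products of classes from the
two orders, products of `D₁`- and `D₂`-basis elements span it and map to a `k`-basis. So gr of `M`
embeds in gr of the whole algebra, which forces each layer of `M` to be the full intersection with
`B`. The same basis argument (`IsCommProduct.isOrder`) makes `B` and gr of `B` orders.

Since three base rings occur, `IsCommProduct` replaces literal tensor products: it only asks for two
commuting images whose products span.

For commutative noetherian `C`, the base change of gr of `B` to `C` is a quotient of `gr B₁ ⊗ (C ⊗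
gr B₂)`. The inner factor is noetherian because `gr B₂` is strongly noetherian, but it need not be
commutative, so `gr B₁` has to be universally noetherian (`IsCommProduct.isNoethRing`). The
reductions of `B` to finite fields are noetherian because their product filtrations have noetherian
gr (`isNoethRing_of_gr`).

The polynomial identity of the reductions is Regev's theorem. A multilinear identity of degree `d`
rewrites every multilinear monomial through those without a decreasing subword of length `d`, and at
most `d ^ (2 * n)` permutations of `n` letters have this property. For two commuting factors the
`n!` monomials therefore lie in a space of dimension less than `n!` once `n` is large, and a linear
relation among them is an identity. -/

namespace AlgFiltration

/-! ### Classes of filtered elements in the associated graded algebra. -/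

section Class

variable {R A : Type*} [CommRing R] [Ring A] [Algebra R A] (F : AlgFiltration R A)

theorem toFun_le_pred {m n : ℕ} (h : m < n) : F.toFun m ≤ F.pred n := by
  cases n with
  | zero => omega
  | succ n => exact F.mono' (Nat.lt_succ_iff.1 h)

/-- The class in the associated graded algebra of an element of the `n`-th layer. -/
def cls (n : ℕ) (a : F.toFun n) : F.Gr := DirectSum.of F.GrPiece n (F.grMk n a)

theorem cls_add (n : ℕ) (a b : F.toFun n) : F.cls n (a + b) = F.cls n a + F.cls n b := by
  rw [cls, map_add, map_add]; rfl

theorem cls_zero (n : ℕ) : F.cls n 0 = 0 := by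
  rw [cls, map_zero, map_zero]; rfl

theorem cls_mul {i j : ℕ} (a : F.toFun i) (b : F.toFun j) :
    F.cls i a * F.cls j b = F.cls (i + j) ⟨(a : A) * b, F.mul_mem' a.2 b.2⟩ :=
  DirectSum.of_mul_of (A := F.GrPiece) (F.grMk i a) (F.grMk j b)

theorem cls_congr {i j : ℕ} (h : i = j) {a : F.toFun i} {b : F.toFun j} (hab : (a : A) = b) :
    F.cls i a = F.cls j b := by
  subst h
  rw [Subtype.ext hab]

theorem grMk_eq_zero_iff {n : ℕ} {x : F.toFun n} : F.grMk n x = 0 ↔ (x : A) ∈ F.pred n :=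
  Submodule.Quotient.mk_eq_zero _

theorem cls_eq_zero_iff {n : ℕ} {a : F.toFun n} : F.cls n a = 0 ↔ (a : A) ∈ F.pred n := by
  rw [← grMk_eq_zero_iff]
  exact (DirectSum.of_injective (β := F.GrPiece) n).eq_iff' (map_zero _)

theorem cls_smul {S : Type*} [CommRing S] [Algebra S R] [Algebra S A] [IsScalarTower S R A]
    (n : ℕ) (s : S) (a : F.toFun n) : F.cls n (s • a) = s • F.cls n a :=
  ((DirectSum.lof S ℕ F.GrPiece n).comp ((F.grMk n).restrictScalars S)).map_smul s a

theorem gr_induction {p : F.Gr → Prop} (h0 : p 0) (hadd : ∀ x y, p x → p y → p (x + y))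
    (hcls : ∀ n a, p (F.cls n a)) (x : F.Gr) : p x := by
  refine DirectSum.induction_on (motive := p) x h0 (fun n a => ?_) hadd
  obtain ⟨a, rfl⟩ := F.grMk_surjective n a
  exact hcls n a

end Class

/-! ### Functoriality of the associated graded algebra. -/

section Map

variable {S R A B : Type*} [CommRing S] [CommRing R] [Ring A] [Ring B] [Algebra S R]
  [Algebra R A] [Algebra S A] [IsScalarTower S R A] [Algebra S B]

/-- The map of layers induced by a filtered homomorphism. -/
def layerMap (G : AlgFiltration S B) (F : AlgFiltration R A) (f : B →ₐ[S] A)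
    (hf : ∀ n, ∀ b ∈ G.toFun n, f b ∈ F.toFun n) (n : ℕ) : G.toFun n →ₗ[S] F.toFun n where
  toFun b := ⟨f b, hf n b b.2⟩
  map_add' a b := Subtype.ext (map_add f (a : B) b)
  map_smul' s b := Subtype.ext (map_smul f s (b : B))

/-- The homomorphism of associated graded algebras induced by a filtered homomorphism. -/
noncomputable def grMap (G : AlgFiltration S B) (F : AlgFiltration R A) (f : B →ₐ[S] A)
    (hf : ∀ n, ∀ b ∈ G.toFun n, f b ∈ F.toFun n) : G.Gr →ₐ[S] F.Gr :=
  DirectSum.toAlgebra S G.GrPiece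
    (fun n => (DirectSum.lof S ℕ F.GrPiece n).comp
      (G.grLift (((F.grMk n).restrictScalars S).comp (layerMap G F f hf n))
        (fun x hx => F.grMk_eq_zero (by
          change f x ∈ F.pred n
          cases n with
          | zero =>
            have h0 : (x : B) = 0 := by simpa [pred] using hx
            rw [h0, map_zero]
            exact Submodule.zero_mem _
          | succ n => exact hf n _ hx))))
    (congrArg (DirectSum.of F.GrPiece 0) (congrArg (F.grMk 0) (Subtype.ext (map_one f))))
    (by
      intro i j a b
      obtain ⟨a, rfl⟩ := G.grMk_surjective _ a
      obtain ⟨b, rfl⟩ := G.grMk_surjective _ b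
      refine Eq.trans ?_ (F.cls_mul ⟨f a, hf i _ a.2⟩ ⟨f b, hf j _ b.2⟩).symm
      exact congrArg (DirectSum.of F.GrPiece (i + j))
        (congrArg (F.grMk (i + j)) (Subtype.ext (map_mul f (a : B) b))))

theorem grMap_cls (G : AlgFiltration S B) (F : AlgFiltration R A) (f : B →ₐ[S] A)
    (hf : ∀ n, ∀ b ∈ G.toFun n, f b ∈ F.toFun n) (n : ℕ) (b : G.toFun n) :
    G.grMap F f hf (G.cls n b) = F.cls n ⟨f b, hf n b b.2⟩ :=
  DirectSum.toAddMonoid_of _ _ _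

theorem grIncl_cls (F : AlgFiltration R A) (B : Subalgebra S A) (n : ℕ)
    (b : (F.induced B).toFun n) :
    F.grIncl B ((F.induced B).cls n b) = F.cls n ⟨((b : B) : A), b.2⟩ :=
  DirectSum.toAddMonoid_of _ _ _

end Map

/-! ### Lifting the noetherian property from the associated graded ring. -/

section Noetherian

variable {R A : Type*} [CommRing R] [Ring A] [Algebra R A] (F : AlgFiltration R A)

/-- The homogeneous component of degree `n`. -/
def component (n : ℕ) : F.Gr →+ F.GrPiece n :=
  DFinsupp.evalAddMonoidHom (β := F.GrPiece) n

theorem component_cls_self (n : ℕ) (a : F.toFun n) : F.component n (F.cls n a) = F.grMk n a :=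
  DirectSum.of_eq_same (β := F.GrPiece) _ _

theorem component_cls_of_ne {m n : ℕ} (h : m ≠ n) (a : F.toFun n) :
    F.component m (F.cls n a) = 0 :=
  DirectSum.of_eq_of_ne (β := F.GrPiece) _ _ _ h

/-- The homogeneous subgroup of the associated graded algebra whose components consist of the
classes of the elements of an additive subgroup `I`. -/
def grAddSubgroup (I : AddSubgroup A) : AddSubgroup F.Gr where
  carrier := {x | ∀ n, ∃ a : F.toFun n, (a : A) ∈ I ∧ F.grMk n a = F.component n x}
  zero_mem' n := ⟨0, I.zero_mem, by rw [map_zero, map_zero]⟩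
  add_mem' {x y} hx hy n := by
    obtain ⟨a, ha, hax⟩ := hx n
    obtain ⟨b, hb, hby⟩ := hy n
    refine ⟨a + b, I.add_mem ha hb, ?_⟩
    rw [map_add, map_add, hax, hby]
  neg_mem' {x} hx n := by
    obtain ⟨a, ha, hax⟩ := hx n
    refine ⟨-a, I.neg_mem ha, ?_⟩
    rw [map_neg, map_neg, hax]

theorem cls_mem_grAddSubgroup_iff (I : AddSubgroup A) (n : ℕ) (a : F.toFun n) :
    F.cls n a ∈ F.grAddSubgroup I ↔ ∃ b : F.toFun n, (b : A) ∈ I ∧ (a : A) - b ∈ F.pred n := by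
  constructor
  · intro h
    obtain ⟨b, hb, hba⟩ := h n
    refine ⟨b, hb, ?_⟩
    rw [component_cls_self] at hba
    rw [← Submodule.coe_sub, ← grMk_eq_zero_iff, map_sub, hba, sub_self]
  · rintro ⟨b, hb, hba⟩ m
    rw [← Submodule.coe_sub, ← grMk_eq_zero_iff, map_sub, sub_eq_zero] at hba
    rcases eq_or_ne m n with rfl | hmn
    · exact ⟨b, hb, by rw [component_cls_self, hba]⟩
    · exact ⟨0, I.zero_mem, by rw [map_zero, component_cls_of_ne _ hmn]⟩

theorem cls_mem_grAddSubgroup (I : AddSubgroup A) (n : ℕ) (a : F.toFun n) (ha : (a : A) ∈ I) :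
    F.cls n a ∈ F.grAddSubgroup I :=
  (F.cls_mem_grAddSubgroup_iff I n a).2 ⟨a, ha, by simp⟩

/-- `grAddSubgroup I` is generated by the classes of the elements of `I`. -/
theorem grAddSubgroup_le_iff (I : AddSubgroup A) (J : AddSubgroup F.Gr) :
    F.grAddSubgroup I ≤ J ↔ ∀ n (a : F.toFun n), (a : A) ∈ I → F.cls n a ∈ J := by
  refine ⟨fun h n a ha => h (F.cls_mem_grAddSubgroup I n a ha), fun h x hx => ?_⟩
  classical
  rw [show x = _ from (DirectSum.sum_support_of (β := F.GrPiece) x).symm]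
  refine AddSubgroup.sum_mem (K := J) (fun n _ => ?_)
  obtain ⟨a, ha, hax⟩ := hx n
  have h' := h n a ha
  rw [cls, hax] at h'
  exact h'

theorem grAddSubgroup_mul_left {I : AddSubgroup A} (hI : ∀ a, ∀ b ∈ I, a * b ∈ I) (x y : F.Gr)
    (hy : y ∈ F.grAddSubgroup I) : x * y ∈ F.grAddSubgroup I := by
  revert y
  change F.grAddSubgroup I ≤ (F.grAddSubgroup I).comap (AddMonoidHom.mulLeft x)
  rw [grAddSubgroup_le_iff]
  intro n b hb
  change x * F.cls n b ∈ F.grAddSubgroup I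
  induction x using F.gr_induction with
  | h0 => rw [zero_mul]; exact AddSubgroup.zero_mem _
  | hadd x y hx hy => rw [add_mul]; exact AddSubgroup.add_mem _ hx hy
  | hcls m a => rw [cls_mul]; exact F.cls_mem_grAddSubgroup I _ _ (hI _ _ hb)

theorem grAddSubgroup_mul_right {I : AddSubgroup A} (hI : ∀ a, ∀ b ∈ I, b * a ∈ I) (x y : F.Gr)
    (hy : y ∈ F.grAddSubgroup I) : y * x ∈ F.grAddSubgroup I := by
  revert y
  change F.grAddSubgroup I ≤ (F.grAddSubgroup I).comap (AddMonoidHom.mulRight x)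
  rw [grAddSubgroup_le_iff]
  intro n b hb
  change F.cls n b * x ∈ F.grAddSubgroup I
  induction x using F.gr_induction with
  | h0 => rw [mul_zero]; exact AddSubgroup.zero_mem _
  | hadd x y hx hy => rw [mul_add]; exact AddSubgroup.add_mem _ hx hy
  | hcls m a => rw [cls_mul]; exact F.cls_mem_grAddSubgroup I _ _ (hI _ _ hb)

/-- If `I ≤ J` have the same classes, an element of `J` agrees modulo the previous layer with an
element of `I`; the difference lies in `J` and in a lower layer, so induction on the layer gives `J
≤ I`. -/
theorem grAddSubgroup_strictMono : StrictMono F.grAddSubgroup := by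
  intro I J hIJ
  refine lt_of_le_not_ge ?_ ?_
  · rw [grAddSubgroup_le_iff]
    exact fun n a ha => F.cls_mem_grAddSubgroup J n a (hIJ.le ha)
  · intro hle
    refine hIJ.not_ge ?_
    have key : ∀ n, ∀ a ∈ F.toFun n, a ∈ J → a ∈ I := by
      intro n
      induction n with
      | zero =>
        intro a ha haJ
        obtain ⟨b, hb, hab⟩ := (F.cls_mem_grAddSubgroup_iff I 0 ⟨a, ha⟩).1
          (hle (F.cls_mem_grAddSubgroup J 0 ⟨a, ha⟩ haJ))
        have : a - b = 0 := by simpa [pred] using hab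
        rw [sub_eq_zero.1 this]
        exact hb
      | succ n ih =>
        intro a ha haJ
        obtain ⟨b, hb, hab⟩ := (F.cls_mem_grAddSubgroup_iff I (n + 1) ⟨a, ha⟩).1
          (hle (F.cls_mem_grAddSubgroup J (n + 1) ⟨a, ha⟩ haJ))
        have := I.add_mem (ih _ hab (J.sub_mem haJ (hIJ.le hb))) hb
        simpa using this
    intro a ha
    obtain ⟨n, hn⟩ := F.exhaustive' a
    exact key n a hn ha

/-- A filtered ring is noetherian if its associated graded ring is. -/
theorem isNoethRing_of_gr (h : IsNoethRing F.Gr) : IsNoethRing A where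
  left := by
    have := h.left
    rw [isNoetherianRing_iff, isNoetherian_iff'] at this ⊢
    let f : Ideal A → Ideal F.Gr := fun I =>
      { F.grAddSubgroup I.toAddSubgroup with
        smul_mem' := fun x _ hy =>
          F.grAddSubgroup_mul_left (I := I.toAddSubgroup) (fun a _ hb => I.mul_mem_left a hb) x _ hy }
    refine StrictMono.wellFoundedGT (f := f) fun I J hIJ => ?_
    exact F.grAddSubgroup_strictMono (a := I.toAddSubgroup) (b := J.toAddSubgroup) hIJ
  right := by
    have := h.right
    rw [isNoetherianRing_iff, isNoetherian_iff'] at this ⊢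
    -- Right ideals are read as additive subgroups of `A` itself, so that the one strictly monotone
    -- map on additive subgroups serves both sides.
    let u : Ideal Aᵐᵒᵖ → AddSubgroup A := fun I =>
      I.toAddSubgroup.comap (MulOpposite.opAddEquiv : A ≃+ Aᵐᵒᵖ).toAddMonoidHom
    let f : Ideal Aᵐᵒᵖ → Ideal F.Grᵐᵒᵖ := fun I =>
      { (F.grAddSubgroup (u I)).comap
          (MulOpposite.opAddEquiv : F.Gr ≃+ F.Grᵐᵒᵖ).symm.toAddMonoidHom with
        smul_mem' := fun x y hy =>
          F.grAddSubgroup_mul_right (I := u I)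
            (fun a _ hb => I.mul_mem_left (MulOpposite.op a) hb) x.unop y.unop hy }
    refine StrictMono.wellFoundedGT (f := f) fun I J hIJ => ?_
    have hu : u I < u J := ⟨fun a ha => hIJ.1 ha, fun h => hIJ.2 fun a ha => h (x := a.unop) ha⟩
    have h := F.grAddSubgroup_strictMono hu
    exact ⟨fun a ha => h.1 ha, fun h' => h.2 fun a ha => h' (x := MulOpposite.op a) ha⟩

end Noetherian

end AlgFiltration

/-! ### Quotients of noetherian rings, and algebras spanned by products from two commuting images.
-/

theorem IsNoethRing.of_surjective {A B : Type*} [Ring A] [Ring B] (f : A →+* B)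
    (hf : Function.Surjective f) (h : IsNoethRing A) : IsNoethRing B where
  left := by
    have := h.left
    exact isNoetherianRing_of_surjective A B f hf
  right := by
    have := h.right
    exact isNoetherianRing_of_surjective Aᵐᵒᵖ Bᵐᵒᵖ f.op fun b => by
      obtain ⟨a, ha⟩ := hf b.unop
      exact ⟨MulOpposite.op a, congrArg MulOpposite.op ha⟩

/-- The `R`-algebra `X` is spanned over `R` by the products of elements of the images of `α₁` and
`α₂`, and these images commute. -/
structure IsCommProduct (R : Type*) {S₁ S₂ G₁ G₂ X : Type*} [CommRing R] [CommRing S₁]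
    [CommRing S₂] [Ring G₁] [Ring G₂] [Ring X] [Algebra S₁ G₁] [Algebra S₂ G₂] [Algebra R X]
    [Algebra S₁ X] [Algebra S₂ X] (α₁ : G₁ →ₐ[S₁] X) (α₂ : G₂ →ₐ[S₂] X) : Prop where
  commute : ∀ a b, Commute (α₁ a) (α₂ b)
  span_eq_top : Submodule.span R (Set.image2 (fun a b => α₁ a * α₂ b) Set.univ Set.univ) = ⊤

section CommProduct

variable {R S₁ S₂ G₁ G₂ X : Type*} [CommRing R] [CommRing S₁]
    [CommRing S₂] [Ring G₁] [Ring G₂] [Ring X] [Algebra S₁ G₁] [Algebra S₂ G₂] [Algebra R X]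
    [Algebra S₁ X] [Algebra S₂ X] {α₁ : G₁ →ₐ[S₁] X} {α₂ : G₂ →ₐ[S₂] X}

/-- The extension to `K ⊗ G` of a homomorphism from `G` to a `K`-algebra. -/
noncomputable def extendScalars (K : Type*) {S G X : Type*} [CommRing K] [CommRing S] [Ring G]
    [Ring X] [Algebra S G] [Algebra S K] [Algebra K X] [Algebra S X] [IsScalarTower S K X]
    (α : G →ₐ[S] X) : K ⊗[S] G →ₐ[K] X :=
  Algebra.TensorProduct.lift (Algebra.ofId K X) α fun c _ => by
    rw [Algebra.ofId_apply]
    exact Algebra.commute_algebraMap_left c _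

theorem extendScalars_tmul (K : Type*) {S G X : Type*} [CommRing K] [CommRing S] [Ring G]
    [Ring X] [Algebra S G] [Algebra S K] [Algebra K X] [Algebra S X] [IsScalarTower S K X]
    (α : G →ₐ[S] X) (c : K) (g : G) : extendScalars K α (c ⊗ₜ g) = c • α g := by
  rw [extendScalars, Algebra.TensorProduct.lift_tmul, Algebra.ofId_apply, Algebra.smul_def]

/-- The factors may be extended to a larger base. -/
theorem IsCommProduct.lift {K₁ K₂ : Type*} [CommRing K₁] [CommRing K₂] [Algebra S₁ K₁] [Algebra S₂ K₂]
    [Algebra K₁ X] [Algebra K₂ X] [IsScalarTower S₁ K₁ X] [IsScalarTower S₂ K₂ X]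
    (h : IsCommProduct R α₁ α₂) :
    IsCommProduct R
      (extendScalars K₁ α₁) (extendScalars K₂ α₂) where
  commute a b := by
    induction a using TensorProduct.induction_on with
    | zero => simp
    | add x y hx hy => rw [map_add]; exact hx.add_left hy
    | tmul x y =>
      induction b using TensorProduct.induction_on with
      | zero => simp
      | add x y hx hy => rw [map_add]; exact hx.add_right hy
      | tmul z w =>
        rw [extendScalars_tmul, extendScalars_tmul, Algebra.smul_def, Algebra.smul_def]
        exact Commute.mul_left (Algebra.commute_algebraMap_left _ _)
          (Commute.mul_right (Algebra.commute_algebraMap_right _ _) (h.commute y w))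
  span_eq_top := by
    rw [eq_top_iff, ← h.span_eq_top]
    refine Submodule.span_mono ?_
    rintro _ ⟨a, -, b, -, rfl⟩
    exact ⟨1 ⊗ₜ a, trivial, 1 ⊗ₜ b, trivial, by
      simp [extendScalars_tmul]⟩

variable [Algebra S₁ R] [Algebra S₂ R] [IsScalarTower S₁ R X] [IsScalarTower S₂ R X]

variable (R α₁ α₂) in
theorem mul_mem_span_image2 {s : Set G₁} {t : Set G₂} {a : G₁} {b : G₂}
    (ha : a ∈ Submodule.span S₁ s) (hb : b ∈ Submodule.span S₂ t) :
    α₁ a * α₂ b ∈ Submodule.span R (Set.image2 (fun a b => α₁ a * α₂ b) s t) := by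
  induction ha using Submodule.span_induction with
  | zero => simp
  | add x y _ _ hx hy => rw [map_add, add_mul]; exact Submodule.add_mem _ hx hy
  | smul r x _ hx =>
    rw [map_smul, smul_mul_assoc, ← algebraMap_smul R r]
    exact Submodule.smul_mem _ _ hx
  | mem x hx =>
    induction hb using Submodule.span_induction with
    | zero => simp
    | add y z _ _ hy hz => rw [map_add, mul_add]; exact Submodule.add_mem _ hy hz
    | smul r y _ hy =>
      rw [map_smul, mul_smul_comm, ← algebraMap_smul R r]
      exact Submodule.smul_mem _ _ hy
    | mem y hy => exact Submodule.subset_span ⟨x, hx, y, hy, rfl⟩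

namespace IsCommProduct

theorem span_eq_top_of_span (h : IsCommProduct R α₁ α₂) {s : Set G₁} {t : Set G₂}
    (hs : Submodule.span S₁ s = ⊤) (ht : Submodule.span S₂ t = ⊤) :
    Submodule.span R (Set.image2 (fun a b => α₁ a * α₂ b) s t) = ⊤ := by
  rw [eq_top_iff, ← h.span_eq_top, Submodule.span_le]
  rintro _ ⟨a, -, b, -, rfl⟩
  exact mul_mem_span_image2 R α₁ α₂ (hs ▸ Submodule.mem_top) (ht ▸ Submodule.mem_top)

/-- Composition with a homomorphism to an algebra over a larger base. -/
theorem comp {C Z : Type*} [CommRing C] [Ring Z] [Algebra R C] [Algebra C Z] [Algebra R Z]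
    [IsScalarTower R C Z] [Algebra S₁ Z] [Algebra S₂ Z] [IsScalarTower S₁ R Z]
    [IsScalarTower S₂ R Z] (h : IsCommProduct R α₁ α₂) (f : X →ₐ[R] Z)
    (hf : Submodule.span C (Set.range f) = ⊤) :
    IsCommProduct C ((f.restrictScalars S₁).comp α₁) ((f.restrictScalars S₂).comp α₂) where
  commute a b := (h.commute a b).map f
  span_eq_top := by
    rw [eq_top_iff, ← hf, Submodule.span_le]
    rintro _ ⟨x, rfl⟩
    have hx : x ∈ Submodule.span R (Set.image2 (fun a b => α₁ a * α₂ b) Set.univ Set.univ) :=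
      h.span_eq_top ▸ Submodule.mem_top
    induction hx using Submodule.span_induction with
    | zero => simp
    | add x y _ _ hx hy =>
      rw [map_add]; exact Submodule.add_mem _ hx hy
    | smul r x _ hx =>
      rw [map_smul, ← algebraMap_smul C r]
      exact Submodule.smul_mem _ _ hx
    | mem x hx =>
      obtain ⟨a, -, b, -, rfl⟩ := hx
      exact Submodule.subset_span ⟨a, trivial, b, trivial, (map_mul f _ _).symm⟩

theorem finiteType (h : IsCommProduct R α₁ α₂) (h₁ : Algebra.FiniteType S₁ G₁)
    (h₂ : Algebra.FiniteType S₂ G₂) : Algebra.FiniteType R X := by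
  classical
  obtain ⟨s, hs⟩ := h₁.out
  obtain ⟨t, ht⟩ := h₂.out
  refine ⟨s.image α₁ ∪ t.image α₂, ?_⟩
  set U := Algebra.adjoin R (↑(s.image α₁ ∪ t.image α₂) : Set X) with hU
  have hs' : ∀ a, α₁ a ∈ U := by
    intro a
    have ha : a ∈ Algebra.adjoin S₁ (s : Set G₁) := hs ▸ Algebra.mem_top
    have : (Algebra.adjoin S₁ (s : Set G₁)) ≤ (U.restrictScalars S₁).comap α₁ := by
      refine Algebra.adjoin_le fun x hx => ?_
      exact Algebra.subset_adjoin (by simpa using Or.inl ⟨x, hx, rfl⟩)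
    exact this ha
  have ht' : ∀ a, α₂ a ∈ U := by
    intro a
    have ha : a ∈ Algebra.adjoin S₂ (t : Set G₂) := ht ▸ Algebra.mem_top
    have : (Algebra.adjoin S₂ (t : Set G₂)) ≤ (U.restrictScalars S₂).comap α₂ := by
      refine Algebra.adjoin_le fun x hx => ?_
      exact Algebra.subset_adjoin (by simpa using Or.inr ⟨x, hx, rfl⟩)
    exact this ha
  rw [← Algebra.toSubmodule_eq_top, eq_top_iff, ← h.span_eq_top, Submodule.span_le]
  rintro _ ⟨a, -, b, -, rfl⟩
  exact U.mul_mem (hs' a) (ht' b)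

end IsCommProduct

end CommProduct

/-- `X` is a quotient of `G₁ ⊗[S₁] (R ⊗[S₂] G₂)`. Strong noetherianity of `G₂` handles the inner
product because `R` is commutative; the outer one has a possibly noncommutative factor and needs the
universal property of `G₁`. -/
theorem IsCommProduct.isNoethRing {R S₁ S₂ G₁ G₂ X : Type u} [CommRing R] [CommRing S₁]
    [CommRing S₂] [Ring G₁] [Ring G₂] [Ring X] [Algebra S₁ G₁] [Algebra S₂ G₂] [Algebra R X]
    [Algebra S₁ X] [Algebra S₂ X] [Algebra S₁ R] [Algebra S₂ R] [IsScalarTower S₁ R X]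
    [IsScalarTower S₂ R X] {α₁ : G₁ →ₐ[S₁] X} {α₂ : G₂ →ₐ[S₂] X}
    (h : IsCommProduct R α₁ α₂) (hR : IsNoetherianRing R)
    (h₁ : IsUniversallyNoetherian S₁ G₁) (h₂ : IsStronglyNoetherian S₂ G₂) : IsNoethRing X := by
  have hY : IsNoethRing (R ⊗[S₂] G₂) :=
    (h₂ R hR).of_surjective (Algebra.TensorProduct.comm S₂ G₂ R).toAlgHom.toRingHom
      (Algebra.TensorProduct.comm S₂ G₂ R).surjective
  let y : R ⊗[S₂] G₂ →ₐ[R] X := extendScalars R α₂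
  let φ : G₁ ⊗[S₁] (R ⊗[S₂] G₂) →ₐ[S₁] X :=
    Algebra.TensorProduct.lift α₁ (y.restrictScalars S₁) fun a b => by
      change Commute (α₁ a) (y b)
      induction b using TensorProduct.induction_on with
      | zero => simp
      | add x y hx hy => rw [map_add]; exact hx.add_right hy
      | tmul z w =>
        rw [extendScalars_tmul, Algebra.smul_def]
        exact Commute.mul_right (Algebra.commute_algebraMap_right _ _) (h.commute a w)
  refine (h₁ _ hY).of_surjective φ.toRingHom fun x => ?_
  change ∃ z, φ z = x
  have hx : x ∈ Submodule.span R (Set.image2 (fun a b => α₁ a * α₂ b) Set.univ Set.univ) :=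
    h.span_eq_top ▸ Submodule.mem_top
  induction hx using Submodule.span_induction with
  | zero => exact ⟨0, map_zero _⟩
  | add x x' _ _ hx hx' =>
    obtain ⟨z, rfl⟩ := hx
    obtain ⟨z', rfl⟩ := hx'
    exact ⟨z + z', map_add _ _ _⟩
  | smul r x _ hx =>
    obtain ⟨z, rfl⟩ := hx
    -- `φ` is only known to be `S₁`-linear, so the scalar `r` is realised as multiplication by a
    -- preimage of `r • 1`.
    refine ⟨(1 ⊗ₜ (r ⊗ₜ 1)) * z, ?_⟩
    rw [map_mul, Algebra.TensorProduct.lift_tmul, map_one, one_mul, AlgHom.restrictScalars_apply,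
      extendScalars_tmul, map_one, smul_mul_assoc, one_mul]
  | mem x hx =>
    obtain ⟨a, -, b, -, rfl⟩ := hx
    refine ⟨a ⊗ₜ (1 ⊗ₜ b), ?_⟩
    rw [Algebra.TensorProduct.lift_tmul, AlgHom.restrictScalars_apply,
      extendScalars_tmul, one_smul]

/-! ### Orders through bases. -/

section Order

/-- A linear map that sends a generating family to a basis over a larger base is injective, its
source is free, and it is a base change. -/
theorem isBaseChange_of_basis {k D X Y ι : Type*} [CommRing k] [CommRing D] [Algebra D k]
    [AddCommGroup X] [AddCommGroup Y] [Module D X] [Module k Y] [Module D Y] [IsScalarTower D k Y]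
    (hDk : Function.Injective (algebraMap D k)) (f : X →ₗ[D] Y) (b : ι → X)
    (hb : ⊤ ≤ Submodule.span D (Set.range b)) (c : Module.Basis ι k Y) (hc : ∀ i, f (b i) = c i) :
    Function.Injective f ∧ Module.Free D X ∧ IsBaseChange k f := by
  -- A `k`-basis stays independent over `D` because `D → k` is injective, and independence of `f ∘
  -- b` pulls back to `b`.
  have hli : LinearIndependent D (f ∘ b) := by
    rw [show f ∘ b = c from funext hc]
    exact c.linearIndependent.restrict_scalars (by
      intro x y hxy
      exact hDk (by simpa [Algebra.smul_def] using hxy))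
  let B : Module.Basis ι D X := Module.Basis.mk hli.of_comp hb
  have hB : ∀ i, B i = b i := fun i => by simp [B]
  refine ⟨?_, Module.Free.of_basis B, ?_⟩
  · rw [← LinearMap.ker_eq_bot]
    exact LinearMap.ker_eq_bot_of_injective (by
      intro x y hxy
      apply B.repr.injective
      have hinj : Function.Injective (Finsupp.linearCombination D (f ∘ b)) := hli
      apply hinj
      have : ∀ x, Finsupp.linearCombination D (f ∘ b) (B.repr x) = f x := by
        intro x
        conv_rhs => rw [← B.linearCombination_repr x]
        rw [← LinearMap.comp_apply, ← Finsupp.linearCombination_linear_comp]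
        simp [show (⇑B) = b from funext hB]
      rw [this, this, hxy])
  · refine IsBaseChange.of_equiv ((B.baseChange k).equiv c (Equiv.refl ι)) fun x => ?_
    let g : X →ₗ[D] Y :=
      (((B.baseChange k).equiv c (Equiv.refl ι)).toLinearMap.restrictScalars D).comp
        (TensorProduct.mk D k X 1)
    have : g = f := B.ext fun i => by
      have h := (B.baseChange k).equiv_apply i c (Equiv.refl ι)
      rw [Module.Basis.baseChange_apply] at h
      rw [hB, hc]
      simpa [g, hB] using h
    exact LinearMap.congr_fun this x

variable {k D D₁ D₂ V₁ V₂ W₁ W₂ X Y : Type*} [Field k] [CommRing D] [CommRing D₁] [CommRing D₂]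
  [Algebra D k] [Algebra D₁ k] [Algebra D₂ k] [Algebra D₁ D] [Algebra D₂ D]
  [Ring V₁] [Ring V₂] [Algebra D₁ V₁] [Algebra D₂ V₂]
  [Ring W₁] [Ring W₂] [Algebra k W₁] [Algebra k W₂] [Algebra D₁ W₁] [Algebra D₂ W₂]
  [IsScalarTower D₁ k W₁] [IsScalarTower D₂ k W₂]
  [Ring X] [Algebra D X] [Algebra D₁ X] [Algebra D₂ X] [IsScalarTower D₁ D X]
  [IsScalarTower D₂ D X] [Ring Y] [Algebra k Y] [Algebra D Y] [IsScalarTower D k Y]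

/-- If `V₁` and `V₂` are orders of `W₁` and `W₂`, then an algebra spanned over `D` by products of
elements of `V₁` and `V₂` is an order of `W₁ ⊗ W₂`. -/
theorem IsCommProduct.isOrder {α₁ : V₁ →ₐ[D₁] X} {α₂ : V₂ →ₐ[D₂] X}
    (hDk : Function.Injective (algebraMap D k)) (h : IsCommProduct D α₁ α₂)
    {f₁ : V₁ →ₐ[D₁] W₁} {f₂ : V₂ →ₐ[D₂] W₂} (h₁ : IsOrder k f₁) (h₂ : IsOrder k f₂)
    (γ₁ : W₁ →ₐ[k] Y) (γ₂ : W₂ →ₐ[k] Y) (hγ : ∀ a b, Commute (γ₁ a) (γ₂ b))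
    (hbij : Function.Bijective (Algebra.TensorProduct.lift γ₁ γ₂ hγ))
    (f : X →ₐ[D] Y) (hf₁ : ∀ v, f (α₁ v) = γ₁ (f₁ v)) (hf₂ : ∀ v, f (α₂ v) = γ₂ (f₂ v)) :
    IsOrder k f := by
  have := h₁.free
  have := h₂.free
  let g := Module.Free.chooseBasis D₁ V₁
  let g' := Module.Free.chooseBasis D₂ V₂
  -- The chosen bases of `V₁` and `V₂` become `k`-bases of `W₁` and `W₂`; their products then form a
  -- `k`-basis of `Y` to which `isBaseChange_of_basis` applies.
  let c := (g.baseChange k).map h₁.baseChange.equiv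
  let c' := (g'.baseChange k).map h₂.baseChange.equiv
  have hc : ∀ i, c i = f₁ (g i) := fun i => by
    simp [c, Module.Basis.baseChange_apply, IsBaseChange.equiv_tmul]
  have hc' : ∀ i, c' i = f₂ (g' i) := fun i => by
    simp [c', Module.Basis.baseChange_apply, IsBaseChange.equiv_tmul]
  let e := (AlgEquiv.ofBijective _ hbij).toLinearEquiv
  have hs := h.span_eq_top_of_span g.span_eq g'.span_eq
  obtain ⟨hi, hfree, hbc⟩ := isBaseChange_of_basis (k := k) hDk f.toLinearMap
    (fun p : _ × _ => α₁ (g p.1) * α₂ (g' p.2))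
    (by
      rw [← hs]
      refine Submodule.span_mono ?_
      rintro _ ⟨_, ⟨i, rfl⟩, _, ⟨j, rfl⟩, rfl⟩
      exact ⟨(i, j), rfl⟩)
    ((c.tensorProduct c').map e)
    (fun p => by
      have : e (c p.1 ⊗ₜ c' p.2) = γ₁ (c p.1) * γ₂ (c' p.2) :=
        Algebra.TensorProduct.lift_tmul _ _ hγ _ _
      rw [Module.Basis.map_apply, Module.Basis.tensorProduct_apply, this, hc, hc', ← hf₁, ← hf₂,
        ← map_mul]
      rfl)
  exact ⟨hi, hfree, hbc⟩

end Order

namespace AlgFiltration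

theorem ext_toFun {R A : Type*} [CommRing R] [Ring A] [Algebra R A] {F G : AlgFiltration R A}
    (h : ∀ n, F.toFun n = G.toFun n) : F = G := by
  cases F
  cases G
  congr
  exact funext h

theorem LocallyFinite.gr {R A : Type*} [CommRing R] [Ring A] [Algebra R A]
    {F : AlgFiltration R A} (h : F.LocallyFinite) : F.GrLocallyFinite := fun n =>
  have := h n
  Module.Finite.of_surjective (F.grMk n) (F.grMk_surjective n)

/-! ### Product filtrations and their associated graded algebras. -/

section Product

variable {R S₁ S₂ A₁ A₂ A : Type*} [CommRing R] [CommRing S₁] [CommRing S₂] [Ring A₁] [Ring A₂]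
  [Ring A] [Algebra S₁ A₁] [Algebra S₂ A₂] [Algebra R A] [Algebra S₁ A] [Algebra S₂ A]

/-- The `n`-th layer of `F` is spanned over `R` by the products `j₁ a * j₂ b` with `a ∈ F₁ r`,
`b ∈ F₂ s` and `r + s ≤ n`. -/
def IsProduct (F₁ : AlgFiltration S₁ A₁) (F₂ : AlgFiltration S₂ A₂) (F : AlgFiltration R A)
    (j₁ : A₁ →ₐ[S₁] A) (j₂ : A₂ →ₐ[S₂] A) : Prop :=
  ∀ n, F.toFun n = Submodule.span R
    {t | ∃ r s : ℕ, r + s ≤ n ∧ ∃ a ∈ F₁.toFun r, ∃ b ∈ F₂.toFun s, j₁ a * j₂ b = t}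

/-- This filtration exists over any base, with no freeness or field assumption. It is used on the
order, before comparison with the induced filtration, and on reductions to finite fields. -/
theorem exists_isProduct (F₁ : AlgFiltration S₁ A₁) (F₂ : AlgFiltration S₂ A₂)
    {j₁ : A₁ →ₐ[S₁] A} {j₂ : A₂ →ₐ[S₂] A} (h : IsCommProduct R j₁ j₂) :
    ∃ F : AlgFiltration R A, IsProduct F₁ F₂ F j₁ j₂ := by
  have hmono : ∀ {m n : ℕ}, m ≤ n →
      Submodule.span R {t | ∃ r s : ℕ, r + s ≤ m ∧
        ∃ a ∈ F₁.toFun r, ∃ b ∈ F₂.toFun s, j₁ a * j₂ b = t} ≤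
      Submodule.span R {t | ∃ r s : ℕ, r + s ≤ n ∧
        ∃ a ∈ F₁.toFun r, ∃ b ∈ F₂.toFun s, j₁ a * j₂ b = t} := by
    intro m n hmn
    refine Submodule.span_mono ?_
    rintro t ⟨r, s, hrs, h⟩
    exact ⟨r, s, hrs.trans hmn, h⟩
  refine ⟨⟨fun n => Submodule.span R
    {t | ∃ r s : ℕ, r + s ≤ n ∧ ∃ a ∈ F₁.toFun r, ∃ b ∈ F₂.toFun s, j₁ a * j₂ b = t},
    fun _ _ => hmono, ?_, ?_, ?_⟩, fun _ => rfl⟩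
  · exact Submodule.subset_span ⟨0, 0, le_rfl, 1, F₁.one_mem', 1, F₂.one_mem', by simp⟩
  · intro i j x y hx hy
    have h' := Submodule.mul_mem_mul hx hy
    rw [Submodule.span_mul_span] at h'
    refine Submodule.span_mono ?_ h'
    rintro _ ⟨_, ⟨r, s, hrs, a, ha, b, hb, rfl⟩, _, ⟨r', s', hrs', a', ha', b', hb', rfl⟩, rfl⟩
    refine ⟨r + r', s + s', by omega, a * a', F₁.mul_mem' ha ha', b * b', F₂.mul_mem' hb hb', ?_⟩
    rw [map_mul, map_mul]
    exact (h.commute a' b).symm.mul_mul_mul_comm _ _ |>.symm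
  · intro x
    have hx : x ∈ Submodule.span R (Set.image2 (fun a b => j₁ a * j₂ b) Set.univ Set.univ) :=
      h.span_eq_top ▸ Submodule.mem_top
    induction hx using Submodule.span_induction with
    | zero => exact ⟨0, Submodule.zero_mem _⟩
    | add x y _ _ hx hy =>
      obtain ⟨m, hm⟩ := hx
      obtain ⟨n, hn⟩ := hy
      exact ⟨max m n, Submodule.add_mem _ (hmono (le_max_left m n) hm)
        (hmono (le_max_right m n) hn)⟩
    | smul r x _ hx =>
      obtain ⟨m, hm⟩ := hx
      exact ⟨m, Submodule.smul_mem _ _ hm⟩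
    | mem x hx =>
      obtain ⟨a, -, b, -, rfl⟩ := hx
      obtain ⟨r, hr⟩ := F₁.exhaustive' a
      obtain ⟨s, hs⟩ := F₂.exhaustive' b
      exact ⟨r + s, Submodule.subset_span ⟨r, s, le_rfl, a, hr, b, hs, rfl⟩⟩

variable {F₁ : AlgFiltration S₁ A₁} {F₂ : AlgFiltration S₂ A₂} {F : AlgFiltration R A}
  {j₁ : A₁ →ₐ[S₁] A} {j₂ : A₂ →ₐ[S₂] A}

namespace IsProduct

theorem mul_mem (h : IsProduct F₁ F₂ F j₁ j₂) {r s n : ℕ} (hrs : r + s ≤ n) {a : A₁} {b : A₂}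
    (ha : a ∈ F₁.toFun r) (hb : b ∈ F₂.toFun s) : j₁ a * j₂ b ∈ F.toFun n := by
  rw [h n]
  exact Submodule.subset_span ⟨r, s, hrs, a, ha, b, hb, rfl⟩

theorem left_mem (h : IsProduct F₁ F₂ F j₁ j₂) (n : ℕ) (a : A₁) (ha : a ∈ F₁.toFun n) :
    j₁ a ∈ F.toFun n := by
  simpa using h.mul_mem (Nat.add_zero n).le ha F₂.one_mem'

theorem right_mem (h : IsProduct F₁ F₂ F j₁ j₂) (n : ℕ) (a : A₂) (ha : a ∈ F₂.toFun n) :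
    j₂ a ∈ F.toFun n := by
  simpa using h.mul_mem (Nat.zero_add n).le F₁.one_mem' ha

variable [Algebra S₁ R] [Algebra S₂ R] [IsScalarTower S₁ R A] [IsScalarTower S₂ R A]

/-- A generator with `r + s < n` has zero class in degree `n`, while one with `r + s = n` has as its
class the product of the two classes. -/
theorem gr (h : IsProduct F₁ F₂ F j₁ j₂) (hc : ∀ a b, Commute (j₁ a) (j₂ b)) :
    IsCommProduct R (F₁.grMap F j₁ h.left_mem) (F₂.grMap F j₂ h.right_mem) where
  commute x y := by
    induction x using F₁.gr_induction with
    | h0 => simp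
    | hadd x x' hx hx' => rw [map_add]; exact hx.add_left hx'
    | hcls m a =>
      induction y using F₂.gr_induction with
      | h0 => simp
      | hadd y y' hy hy' => rw [map_add]; exact hy.add_right hy'
      | hcls n b =>
        rw [grMap_cls, grMap_cls, Commute, SemiconjBy, cls_mul, cls_mul]
        exact F.cls_congr (add_comm m n) (hc a b)
  span_eq_top := by
    rw [eq_top_iff]
    rintro x -
    induction x using F.gr_induction with
    | h0 => exact Submodule.zero_mem _
    | hadd x y hx hy => exact Submodule.add_mem _ hx hy
    | hcls n c =>
      obtain ⟨c, hc'⟩ := c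
      have hcs := hc'
      rw [h n] at hcs
      induction hcs using Submodule.span_induction with
      | zero =>
        rw [show (⟨0, hc'⟩ : F.toFun n) = 0 from rfl, cls_zero]
        exact Submodule.zero_mem _
      | add x y hx hy hx' hy' =>
        rw [← h n] at hx hy
        have := Submodule.add_mem _ (hx' hx) (hy' hy)
        rw [← cls_add] at this
        exact this
      | smul r x hx hx' =>
        rw [← h n] at hx
        have := Submodule.smul_mem _ r (hx' hx)
        rw [← cls_smul] at this
        exact this
      | mem x hx =>
        obtain ⟨r, s, hrs, a, ha, b, hb, rfl⟩ := hx
        rcases hrs.lt_or_eq with hlt | rfl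
        · rw [F.cls_eq_zero_iff.2 (F.toFun_le_pred hlt (h.mul_mem le_rfl ha hb))]
          exact Submodule.zero_mem _
        · refine Submodule.subset_span ⟨F₁.cls r ⟨a, ha⟩, trivial, F₂.cls s ⟨b, hb⟩, trivial, ?_⟩
          change _ * _ = _
          rw [grMap_cls, grMap_cls, cls_mul]

/-- Enlarging `r` to `n - s` shows that the pairs with `r + s = n` suffice. There are finitely many
of them, and each contributes the products of two finite generating sets. -/
theorem locallyFinite (h : IsProduct F₁ F₂ F j₁ j₂) (h₁ : F₁.LocallyFinite)
    (h₂ : F₂.LocallyFinite) : F.LocallyFinite := by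
  intro n
  have h₁' : ∀ r, ∃ s : Set A₁, s.Finite ∧ Submodule.span S₁ s = F₁.toFun r := fun r =>
    Submodule.fg_def.1 (Module.Finite.iff_fg.1 (h₁ r))
  have h₂' : ∀ r, ∃ s : Set A₂, s.Finite ∧ Submodule.span S₂ s = F₂.toFun r := fun r =>
    Submodule.fg_def.1 (Module.Finite.iff_fg.1 (h₂ r))
  choose s hs hs' using h₁'
  choose t ht ht' using h₂'
  rw [Module.Finite.iff_fg, Submodule.fg_def]
  refine ⟨⋃ p ∈ Finset.HasAntidiagonal.antidiagonal n,
    Set.image2 (fun a b => j₁ a * j₂ b) (s p.1) (t p.2), ?_, le_antisymm ?_ ?_⟩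
  · exact Set.Finite.biUnion (Finset.finite_toSet _) fun p _ => (hs _).image2 _ (ht _)
  · rw [Submodule.span_le]
    intro x hx
    simp only [Set.mem_iUnion] at hx
    obtain ⟨p, hp, a, ha, b, hb, rfl⟩ := hx
    refine h.mul_mem (Finset.HasAntidiagonal.mem_antidiagonal.1 hp).le ?_ ?_
    · rw [← hs']; exact Submodule.subset_span ha
    · rw [← ht']; exact Submodule.subset_span hb
  · rw [h n, Submodule.span_le]
    rintro _ ⟨r, q, hrq, a, ha, b, hb, rfl⟩
    have ha' := F₁.mono' (show r ≤ n - q by omega) ha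
    rw [← hs'] at ha'
    rw [← ht'] at hb
    refine Submodule.span_mono ?_ (mul_mem_span_image2 R j₁ j₂ ha' hb)
    intro x hx
    simp only [Set.mem_iUnion]
    exact ⟨(n - q, q), Finset.HasAntidiagonal.mem_antidiagonal.2 (by simp; omega), hx⟩

end IsProduct

end Product

/-! ### The associated graded algebra of a tensor product over a field. -/

section TensorGr

variable {k A₁ A₂ A : Type*} [Field k] [Ring A₁] [Ring A₂] [Ring A] [Algebra k A₁] [Algebra k A₂]
  [Algebra k A]

/-- Over a field the quotient map `F n → F n / F (n - 1)` extends to the whole algebra. -/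
theorem exists_extend_cls (F : AlgFiltration k A) (n : ℕ) :
    ∃ t : A →ₗ[k] F.Gr, ∀ a : F.toFun n, t a = F.cls n a := by
  let c : F.toFun n →ₗ[k] F.Gr :=
    { toFun := F.cls n, map_add' := F.cls_add n, map_smul' := F.cls_smul n }
  obtain ⟨p, hp⟩ := LinearMap.exists_leftInverse_of_injective (F.toFun n).subtype
    (Submodule.ker_subtype _)
  exact ⟨c.comp p, fun a => congrArg c (LinearMap.congr_fun hp a)⟩

/-- The associated graded algebra of a tensor product of filtered algebras over a field is the
tensor product of the associated graded algebras. -/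
theorem IsProduct.bijective_gr {F₁ : AlgFiltration k A₁} {F₂ : AlgFiltration k A₂}
    {F : AlgFiltration k A} {j₁ : A₁ →ₐ[k] A} {j₂ : A₂ →ₐ[k] A} (h : IsProduct F₁ F₂ F j₁ j₂)
    (hc : ∀ a b, Commute (j₁ a) (j₂ b))
    (hbij : Function.Bijective (Algebra.TensorProduct.lift j₁ j₂ hc)) :
    Function.Bijective (Algebra.TensorProduct.lift (F₁.grMap F j₁ h.left_mem)
      (F₂.grMap F j₂ h.right_mem) (h.gr hc).commute) := by
  set φ := Algebra.TensorProduct.lift (F₁.grMap F j₁ h.left_mem)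
      (F₂.grMap F j₂ h.right_mem) (h.gr hc).commute with hφ
  constructor
  · choose t₁ ht₁ using F₁.exists_extend_cls
    choose t₂ ht₂ using F₂.exists_extend_cls
    have ht₁0 : ∀ {m n : ℕ}, m < n → ∀ a ∈ F₁.toFun m, t₁ n a = 0 := fun hmn a ha => by
      rw [ht₁ _ ⟨a, F₁.mono' hmn.le ha⟩, cls_eq_zero_iff]
      exact F₁.toFun_le_pred hmn ha
    have ht₂0 : ∀ {m n : ℕ}, m < n → ∀ a ∈ F₂.toFun m, t₂ n a = 0 := fun hmn a ha => by
      rw [ht₂ _ ⟨a, F₂.mono' hmn.le ha⟩, cls_eq_zero_iff]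
      exact F₂.toFun_le_pred hmn ha
    let e : A₁ ⊗[k] A₂ ≃ₗ[k] A := (AlgEquiv.ofBijective _ hbij).toLinearEquiv
    have he : ∀ a b, e.symm (j₁ a * j₂ b) = a ⊗ₜ b := fun a b => by
      rw [LinearEquiv.symm_apply_eq]
      exact (Algebra.TensorProduct.lift_tmul _ _ hc _ _).symm
    -- The degree `n` part of a left inverse. The values of `t₁ p` and `t₂ q` above their layers are
    -- arbitrary but harmless: for `a ∈ F₁ r`, `b ∈ F₂ s` with `r + s ≤ n`, every term with `(p, q)
    -- ≠ (r, s)` has `r < p` or `s < q`, hence a zero factor.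
    let Φ : ℕ → A →ₗ[k] F₁.Gr ⊗[k] F₂.Gr := fun n =>
      (∑ p ∈ Finset.HasAntidiagonal.antidiagonal n, TensorProduct.map (t₁ p.1) (t₂ p.2)).comp
        e.symm.toLinearMap
    have hΦ : ∀ n a b, Φ n (j₁ a * j₂ b) =
        ∑ p ∈ Finset.HasAntidiagonal.antidiagonal n, t₁ p.1 a ⊗ₜ[k] t₂ p.2 b := by
      intro n a b
      simp [Φ, he]
    have hker : ∀ m n, m < n → F.toFun m ≤ LinearMap.ker (Φ n) := by
      intro m n hmn
      rw [h m, Submodule.span_le]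
      rintro _ ⟨r, s, hrs, a, ha, b, hb, rfl⟩
      change Φ n _ = 0
      rw [hΦ]
      refine Finset.sum_eq_zero fun p hp => ?_
      rw [Finset.HasAntidiagonal.mem_antidiagonal] at hp
      rcases lt_or_ge r p.1 with h1 | h1
      · rw [ht₁0 h1 a ha, TensorProduct.zero_tmul]
      · rw [ht₂0 (show s < p.2 by omega) b hb, TensorProduct.tmul_zero]
    let Ψ : F.Gr →ₗ[k] F₁.Gr ⊗[k] F₂.Gr := DirectSum.toModule k ℕ _ fun n =>
      F.grLift ((Φ n).comp (F.toFun n).subtype) fun x hx => by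
        cases n with
        | zero =>
          have h0 : (x : A) = 0 := by simpa [pred] using hx
          simp [h0]
        | succ n => exact hker n (n + 1) n.lt_succ_self hx
    have hΨ : ∀ n a, Ψ (F.cls n a) = Φ n a := fun n a => DirectSum.toModule_lof k _ _
    have hΨφ : ∀ x, Ψ (φ x) = x := by
      intro x
      induction x using TensorProduct.induction_on with
      | zero => simp
      | add x y hx hy => rw [map_add, map_add, hx, hy]
      | tmul x y =>
        induction x using F₁.gr_induction with
        | h0 => simp
        | hadd x x' hx hx' => rw [TensorProduct.add_tmul, map_add, map_add, hx, hx']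
        | hcls m a =>
          induction y using F₂.gr_induction with
          | h0 => simp
          | hadd y y' hy hy' => rw [TensorProduct.tmul_add, map_add, map_add, hy, hy']
          | hcls n b =>
            rw [hφ, Algebra.TensorProduct.lift_tmul, grMap_cls, grMap_cls, cls_mul, hΨ, hΦ,
              Finset.sum_eq_single (m, n), ht₁, ht₂]
            · intro p hp hne
              rw [Finset.HasAntidiagonal.mem_antidiagonal] at hp
              rcases lt_trichotomy m p.1 with h1 | h1 | h1
              · rw [ht₁0 h1 _ a.2, TensorProduct.zero_tmul]
              · exact absurd (Prod.ext h1.symm (by omega)) hne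
              · rw [ht₂0 (show n < p.2 by omega) _ b.2, TensorProduct.tmul_zero]
            · intro hn
              exact absurd (Finset.HasAntidiagonal.mem_antidiagonal (a := (m, n)).2 rfl) hn
    exact Function.LeftInverse.injective hΨφ
  · rw [← AlgHom.range_eq_top, ← Algebra.toSubmodule_eq_top, eq_top_iff,
      ← (h.gr hc).span_eq_top, Submodule.span_le]
    rintro _ ⟨x, -, y, -, rfl⟩
    exact ⟨x ⊗ₜ y, Algebra.TensorProduct.lift_tmul _ _ _ _ _⟩

end TensorGr

end AlgFiltration

/-! ### Polynomial identities and multilinear identities. -/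

section Multilinearization

/-- Toggling a fixed element outside `s` pairs the sets containing `s` with opposite signs. -/
theorem sum_powerset_filter_neg_one_pow {d : ℕ} (s : Finset (Fin d)) (hs : s ≠ Finset.univ) :
    ∑ T : Finset (Fin d), (if s ⊆ T then (-1 : ℤ) ^ T.card else 0) = 0 := by
  obtain ⟨t, ht⟩ : ∃ t, t ∉ s := by
    by_contra! h
    exact hs (Finset.eq_univ_iff_forall.2 h)
  refine Finset.sum_involution (fun T _ => if t ∈ T then T.erase t else insert t T) ?_ ?_ ?_ ?_
  · intro T _
    have hiff : s ⊆ (if t ∈ T then T.erase t else insert t T) ↔ s ⊆ T := by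
      split_ifs with h
      · exact Finset.subset_erase.trans (and_iff_left ht)
      · exact Finset.subset_insert_iff_of_notMem ht
    by_cases hsT : s ⊆ T
    · rw [if_pos (hiff.2 hsT), if_pos hsT]
      split_ifs with h
      · rw [← Finset.card_erase_add_one h, pow_succ]
        ring
      · rw [Finset.card_insert_of_notMem h, pow_succ]
        ring
    · rw [if_neg (mt hiff.1 hsT), if_neg hsT, add_zero]
  · intro T _ _ h
    split_ifs at h with h'
    · exact Finset.notMem_erase t T (h.symm ▸ h')
    · exact h' (h ▸ Finset.mem_insert_self t T)
  · intro T _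
    exact Finset.mem_univ _
  · intro T _
    by_cases h : t ∈ T
    · simp [h, Finset.insert_erase h]
    · simp [h, Finset.erase_insert h]

/-- Inclusion-exclusion isolates the terms of a product of sums that involve every variable. -/
theorem sum_neg_one_pow_prod_sum {A : Type*} [Ring A] {d m : ℕ} (u : Fin d → ℕ) (v : Fin m → ℕ)
    (z : Fin d → A) :
    ∑ T : Finset (Fin d), (-1 : ℤ) ^ T.card •
        (List.ofFn fun s => ∑ t ∈ T with u t = v s, z t).prod =
      ∑ r : Fin m → Fin d, if Function.Surjective r ∧ ∀ s, u (r s) = v s then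
        (-1 : ℤ) ^ d • (List.ofFn fun s => z (r s)).prod else 0 := by
  classical
  have h1 : ∀ T : Finset (Fin d), (List.ofFn fun s => ∑ t ∈ T with u t = v s, z t).prod =
      ∑ r : Fin m → Fin d, if (∀ s, r s ∈ T) ∧ ∀ s, u (r s) = v s then
        (List.ofFn fun s => z (r s)).prod else 0 := by
    intro T
    have := (MultilinearMap.mkPiAlgebraFin ℤ m A).map_sum_finset (fun _ t => z t)
      (fun s => {t ∈ T | u t = v s})
    simp only [MultilinearMap.mkPiAlgebraFin_apply] at this
    rw [this, ← Finset.sum_filter]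
    refine Finset.sum_congr ?_ fun _ _ => rfl
    ext r
    simp [Fintype.mem_piFinset, forall_and]
  simp_rw [h1, Finset.smul_sum]
  rw [Finset.sum_comm]
  refine Finset.sum_congr rfl fun r _ => ?_
  by_cases hr : ∀ s, u (r s) = v s
  -- The product indexed by `r` occurs exactly for the `T` containing the image of `r`, so its total
  -- coefficient vanishes unless `r` is surjective.
  · have h2 : ∀ T : Finset (Fin d), ((-1 : ℤ) ^ T.card •
        if (∀ s, r s ∈ T) ∧ ∀ s, u (r s) = v s then (List.ofFn fun s => z (r s)).prod else 0) =
        (if Finset.univ.image r ⊆ T then (-1 : ℤ) ^ T.card else 0) •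
          (List.ofFn fun s => z (r s)).prod := by
      intro T
      have : Finset.univ.image r ⊆ T ↔ ∀ s, r s ∈ T := by simp [Finset.image_subset_iff]
      by_cases hT : ∀ s, r s ∈ T
      · rw [if_pos ⟨hT, hr⟩, if_pos (this.2 hT)]
      · rw [if_neg (fun h => hT h.1), if_neg (mt this.1 hT), smul_zero, zero_smul]
    simp_rw [h2]
    rw [← Finset.sum_smul]
    by_cases hsurj : Function.Surjective r
    · rw [if_pos ⟨hsurj, hr⟩, Finset.image_univ_of_surjective hsurj]
      congr 1
      simp [Finset.univ_subset_iff]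
    · rw [if_neg (fun h => hsurj h.1), sum_powerset_filter_neg_one_pow, zero_smul]
      intro h
      refine hsurj fun t => ?_
      have ht : t ∈ Finset.univ.image r := h ▸ Finset.mem_univ t
      simpa using ht
  · simp [hr]

theorem FreeAlgebra.lift_eq_sum {K A : Type*} [Field K] [Ring A] [Algebra K A]
    (f : FreeAlgebra K ℕ) (x : ℕ → A) :
    FreeAlgebra.lift K x f = ∑ w ∈ (FreeAlgebra.equivMonoidAlgebraFreeMonoid f).coeff.support,
      (FreeAlgebra.equivMonoidAlgebraFreeMonoid f).coeff w • (w.toList.map x).prod := by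
  obtain ⟨g, rfl⟩ := FreeAlgebra.equivMonoidAlgebraFreeMonoid.symm.surjective f
  have h : (FreeAlgebra.lift K x).comp
      (FreeAlgebra.equivMonoidAlgebraFreeMonoid (R := K) (X := ℕ)).symm.toAlgHom =
      MonoidAlgebra.lift K A (FreeMonoid ℕ) (FreeMonoid.lift x) := by
    refine MonoidAlgebra.algHom_ext' ?_ (AlgHom.ext fun r => ?_)
    · ext i
      simp [FreeAlgebra.equivMonoidAlgebraFreeMonoid]
    · rw [show r = algebraMap K K r from rfl, AlgHom.commutes, AlgHom.commutes]
  rw [AlgEquiv.apply_symm_apply]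
  refine (AlgHom.congr_fun h g).trans ?_
  rw [MonoidAlgebra.lift_apply]
  refine Finset.sum_congr rfl fun w _ => ?_
  change _ • FreeMonoid.lift x w = _
  rw [FreeMonoid.lift_apply]

/-- A polynomial identity algebra satisfies a proper multilinear identity. -/
theorem IsPIAlgebra.exists_multilinear {K A : Type*} [Field K] [Ring A] [Algebra K A]
    (h : IsPIAlgebra K A) : ∃ (d : ℕ) (α : Equiv.Perm (Fin d) → K), α 1 ≠ 0 ∧
      ∀ z : Fin d → A, ∑ σ, α σ • (List.ofFn fun i => z (σ i)).prod = 0 := by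
  classical
  obtain ⟨f, hf, hid⟩ := h
  set g := (FreeAlgebra.equivMonoidAlgebraFreeMonoid f).coeff with hg
  have hg0 : g ≠ 0 := by
    rw [hg]
    refine fun h => absurd (MonoidAlgebra.coeff_injective (h.trans MonoidAlgebra.coeff_zero.symm)) ?_
    exact (map_ne_zero_iff _ FreeAlgebra.equivMonoidAlgebraFreeMonoid.injective).2 hf
  have hne : g.support.Nonempty := Finsupp.support_nonempty_iff.2 hg0
  -- A longest monomial of `f` fixes the degree. Variable `j` is replaced by the sum of the `z t`,
  -- `t ∈ T`, over the positions `t` where `w₀` has the letter `j`, and the results are added with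
  -- signs over all `T`. Shorter monomials cancel, and those of length `d` leave only rearrangements
  -- of `w₀`; the coefficient at the identity permutation is that of `w₀`, hence nonzero.
  obtain ⟨w₀, hw₀, hmax⟩ := Finset.exists_max_image g.support (fun w => w.toList.length) hne
  set d := w₀.toList.length with hd
  let u : Fin d → ℕ := w₀.toList.get
  let wd : Equiv.Perm (Fin d) → FreeMonoid ℕ := fun σ =>
    FreeMonoid.ofList (List.ofFn fun i => u (σ i))
  refine ⟨d, fun σ => g (wd σ), ?_, fun z => ?_⟩
  · have : wd 1 = w₀ := congrArg FreeMonoid.ofList (List.ofFn_get w₀.toList)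
    change g (wd 1) ≠ 0
    rw [this]
    exact Finsupp.mem_support_iff.1 hw₀
  · have key : ∀ w ∈ g.support, ∑ T : Finset (Fin d), (-1 : ℤ) ^ T.card •
        (w.toList.map fun j => ∑ t ∈ T with u t = j, z t).prod =
        ∑ σ : Equiv.Perm (Fin d), if w = wd σ then
          (-1 : ℤ) ^ d • (List.ofFn fun i => z (σ i)).prod else 0 := by
      intro w hw
      obtain ⟨m, v, hv⟩ : ∃ (m : ℕ) (v : Fin m → ℕ), w.toList = List.ofFn v :=
        ⟨_, _, (List.ofFn_get w.toList).symm⟩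
      have hwv : w = FreeMonoid.ofList (List.ofFn v) := by rw [← hv]; rfl
      have hm : m ≤ d := by
        have := hmax w hw
        rwa [hv, List.length_ofFn] at this
      simp_rw [hv, List.map_ofFn]
      refine (sum_neg_one_pow_prod_sum u v z).trans ?_
      -- If `m < d`, no map `Fin m → Fin d` is surjective; if `m = d`, the surjective ones are the
      -- permutations.
      rcases hm.lt_or_eq with hlt | rfl
      · rw [Finset.sum_eq_zero, Finset.sum_eq_zero]
        · intro σ _
          rw [if_neg]
          intro hwσ
          have := congrArg (fun w => w.toList.length) hwσ
          simp [hv, wd] at this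
          omega
        · intro r _
          rw [if_neg]
          rintro ⟨hr, -⟩
          have := Fintype.card_le_of_surjective r hr
          simp at this
          omega
      · rw [← Finset.sum_filter, ← Finset.sum_filter]
        symm
        refine Finset.sum_bij (fun σ _ => ⇑σ) ?_ ?_ ?_ ?_
        · intro σ hσ
          rw [Finset.mem_filter] at hσ ⊢
          refine ⟨Finset.mem_univ _, σ.surjective, fun s => ?_⟩
          have h1 : List.ofFn v = List.ofFn fun i => u (σ i) := hwv.symm.trans hσ.2
          exact (congrFun (List.ofFn_injective h1) s).symm
        · intro σ _ τ _ hστ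
          exact DFunLike.coe_injective hστ
        · intro r hr
          rw [Finset.mem_filter] at hr
          refine ⟨Equiv.ofBijective r ⟨Finite.injective_iff_surjective.2 hr.2.1, hr.2.1⟩, ?_, rfl⟩
          rw [Finset.mem_filter]
          refine ⟨Finset.mem_univ _, hwv.trans ?_⟩
          exact congrArg FreeMonoid.ofList (congrArg List.ofFn (funext fun s => (hr.2.2 s).symm))
        · intro σ _
          rfl
    have h0 : ∑ T : Finset (Fin d), (-1 : ℤ) ^ T.card •
        FreeAlgebra.lift K (fun j => ∑ t ∈ T with u t = j, z t) f = 0 :=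
      Finset.sum_eq_zero fun T _ => by rw [hid, smul_zero]
    simp_rw [FreeAlgebra.lift_eq_sum, Finset.smul_sum] at h0
    rw [Finset.sum_comm] at h0
    have h1 : ∀ w ∈ g.support, ∑ T : Finset (Fin d), (-1 : ℤ) ^ T.card •
        g w • (w.toList.map fun j => ∑ t ∈ T with u t = j, z t).prod =
        ∑ σ : Equiv.Perm (Fin d), if w = wd σ then
          g w • (-1 : ℤ) ^ d • (List.ofFn fun i => z (σ i)).prod else 0 := by
      intro w hw
      simp_rw [smul_comm _ (g w)]
      rw [← Finset.smul_sum, key w hw, Finset.smul_sum]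
      exact Finset.sum_congr rfl fun σ _ => by rw [smul_ite, smul_zero]
    rw [Finset.sum_congr rfl h1, Finset.sum_comm] at h0
    have h2 : ∀ σ : Equiv.Perm (Fin d), (∑ w ∈ g.support, if w = wd σ then
          g w • (-1 : ℤ) ^ d • (List.ofFn fun i => z (σ i)).prod else 0) =
        (-1 : ℤ) ^ d • g (wd σ) • (List.ofFn fun i => z (σ i)).prod := by
      intro σ
      rw [Finset.sum_ite_eq', smul_comm]
      split_ifs with h
      · rfl
      · rw [Finsupp.notMem_support_iff.1 h, zero_smul, smul_zero]
    simp_rw [h2] at h0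
    rw [← Finset.smul_sum] at h0
    rcases neg_one_pow_eq_or ℤ d with h | h <;> simpa [h] using h0

/-- A nontrivial multilinear identity is a polynomial identity. -/
theorem isPIAlgebra_of_multilinear {K A : Type*} [Field K] [Ring A] [Algebra K A] {n : ℕ}
    (γ : Equiv.Perm (Fin n) → K) (hγ : ∃ π, γ π ≠ 0)
    (h : ∀ z : Fin n → A, ∑ π, γ π • (List.ofFn fun i => z (π i)).prod = 0) :
    IsPIAlgebra K A := by
  refine ⟨∑ π, γ π • (List.ofFn fun i => FreeAlgebra.ι K (π i : ℕ)).prod, ?_, fun x => ?_⟩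
  · obtain ⟨π₀, hπ₀⟩ := hγ
    intro h0
    have h1 := congrArg FreeAlgebra.equivMonoidAlgebraFreeMonoid h0
    have hword : ∀ l : List ℕ, FreeAlgebra.equivMonoidAlgebraFreeMonoid
        (l.map (FreeAlgebra.ι K)).prod = MonoidAlgebra.single (FreeMonoid.ofList l) 1 := by
      intro l
      induction l with
      | nil => exact map_one _
      | cons i l ih =>
        rw [List.map_cons, List.prod_cons, map_mul, ih]
        simp [FreeAlgebra.equivMonoidAlgebraFreeMonoid, MonoidAlgebra.single_mul_single]
    have h2 : ∀ π : Equiv.Perm (Fin n), FreeAlgebra.equivMonoidAlgebraFreeMonoid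
        (List.ofFn fun i => FreeAlgebra.ι K (π i : ℕ)).prod =
        MonoidAlgebra.single (FreeMonoid.ofList (List.ofFn fun i => (π i : ℕ))) 1 := by
      intro π
      rw [← hword, List.map_ofFn]
      rfl
    rw [map_sum, map_zero] at h1
    simp_rw [map_smul, h2] at h1
    have h3 := congrArg
      (fun p => p.coeff (FreeMonoid.ofList (List.ofFn fun i => (π₀ i : ℕ)))) h1
    simp only [MonoidAlgebra.coeff_sum, MonoidAlgebra.coeff_smul, MonoidAlgebra.coeff_single,
      Finsupp.finsetSum_apply, Finsupp.smul_apply, MonoidAlgebra.coeff_zero,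
      Finsupp.zero_apply] at h3
    rw [Finset.sum_eq_single π₀] at h3
    · rw [Finsupp.single_eq_same, smul_eq_mul, mul_one] at h3
      exact hπ₀ h3
    · intro π _ hne
      rw [Finsupp.single_eq_of_ne, smul_zero]
      intro h4
      refine hne (Equiv.ext fun i => Fin.ext ?_)
      exact (congrFun (List.ofFn_injective (FreeMonoid.ofList.injective h4)) i).symm
    · intro h4
      exact absurd (Finset.mem_univ _) h4
  · rw [map_sum, ← h fun i => x i]
    refine Finset.sum_congr rfl fun π _ => ?_
    rw [map_smul, map_list_prod, List.map_ofFn]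
    congr 3
    funext i
    simp

end Multilinearization

/-! ### Rewriting words by good rearrangements. -/

section Words

/-- A word is `d`-good if it has no strictly decreasing subword of length `d`. -/
def List.IsGood {β : Type*} [LT β] (d : ℕ) (w : List β) : Prop :=
  ∀ l : List β, l.Sublist w → l.Pairwise (· > ·) → l.length ≠ d

/-- A word with a given subword splits into blocks starting with the letters of the subword. -/
theorem List.Sublist.exists_blocks {β : Type*} {l w : List β} (h : l.Sublist w) :
    ∃ (w₀ : List β) (us : List (List β)),
      w = w₀ ++ us.flatten ∧ us.map List.head? = l.map some := by
  induction h with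
  | slnil => exact ⟨[], [], rfl, rfl⟩
  | cons a _ ih =>
    obtain ⟨w₀, us, rfl, hus⟩ := ih
    exact ⟨a :: w₀, us, rfl, hus⟩
  | cons_cons a _ ih =>
    obtain ⟨w₀, us, rfl, hus⟩ := ih
    exact ⟨[], (a :: w₀) :: us, by simp, by simp [hus]⟩

/-- Permuting blocks with decreasing first letters makes a word lexicographically smaller. -/
theorem List.flatten_lt_of_perm {β : Type*} [LinearOrder β] :
    ∀ {us vs : List (List β)} {l : List β}, us.map List.head? = l.map some →
      l.Pairwise (· > ·) → vs.Perm us → vs ≠ us → vs.flatten < us.flatten := by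
  intro us
  induction us with
  | nil =>
    intro vs l _ _ hp hne
    exact absurd hp.eq_nil hne
  | cons u us ih =>
    intro vs l hl hd hp hne
    obtain _ | ⟨y, l⟩ := l
    · simp at hl
    obtain _ | ⟨v, vs⟩ := vs
    · exact absurd hp.symm.eq_nil (List.cons_ne_nil _ _)
    rw [List.map_cons, List.map_cons, List.cons.injEq] at hl
    rw [List.pairwise_cons] at hd
    rw [List.flatten_cons, List.flatten_cons]
    -- The first block that differs decides: it comes from a later position, so its first letter is
    -- strictly smaller.
    by_cases huv : v = u
    · subst huv
      exact List.append_left_lt (ih hl.2 hd.2 hp.cons_inv fun h => hne (by rw [h]))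
    · have hv : v ∈ us := by
        have := hp.subset List.mem_cons_self
        exact (List.mem_cons.1 this).resolve_left huv
      have hv' : v.head? ∈ l.map some := hl.2 ▸ List.mem_map_of_mem hv
      obtain ⟨y', hy', hvy⟩ := List.mem_map.1 hv'
      obtain ⟨u', rfl⟩ : ∃ u', u = y :: u' := List.head?_eq_some_iff.1 hl.1
      obtain ⟨v', rfl⟩ : ∃ v', v = y' :: v' := List.head?_eq_some_iff.1 hvy.symm
      exact List.Lex.rel (hd.1 y' hy')

variable {K X : Type*} [Field K] [Ring X] [Algebra K X] (S : Submonoid X)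

/-- The value of a word, as a function of the values of its letters in `S`. -/
def wordEval {n : ℕ} (w : List (Fin n)) (x : Fin n → S) : X := (w.map fun i => (x i : X)).prod

theorem wordEval_append {n : ℕ} (v w : List (Fin n)) (x : Fin n → S) :
    wordEval S (v ++ w) x = wordEval S v x * wordEval S w x := by
  simp [wordEval]

theorem wordEval_mem {n : ℕ} (w : List (Fin n)) (x : Fin n → S) : wordEval S w x ∈ S := by
  refine Submonoid.list_prod_mem _ fun y hy => ?_
  obtain ⟨i, -, rfl⟩ := List.mem_map.1 hy
  exact (x i).2

theorem wordEval_flatten {n : ℕ} (us : List (List (Fin n))) (x : Fin n → S) :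
    wordEval S us.flatten x = (us.map fun u => wordEval S u x).prod := by
  induction us with
  | nil => simp [wordEval]
  | cons u us ih => rw [List.flatten_cons, wordEval_append, ih, List.map_cons, List.prod_cons]

/-- If the elements of `S` satisfy a proper multilinear identity of degree `d`, then every word is
a linear combination of `d`-good rearrangements. -/
theorem wordEval_mem_span_isGood {d : ℕ} (α : Equiv.Perm (Fin d) → K) (hα : α 1 ≠ 0)
    (hid : ∀ z : Fin d → X, (∀ i, z i ∈ S) → ∑ σ, α σ • (List.ofFn fun i => z (σ i)).prod = 0)
    {n : ℕ} (w : List (Fin n)) :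
    wordEval S w ∈ Submodule.span K (wordEval S '' {v | v.Perm w ∧ v.IsGood d}) := by
  -- Lexicographic induction is available because there are finitely many words of the given length.
  have hwf := (List.finite_length_eq (Fin n) w.length).wellFoundedOn (r := (· < ·))
  have key : ∀ v : List (Fin n), v.length = w.length →
      wordEval S v ∈ Submodule.span K (wordEval S '' {v' | v'.Perm v ∧ v'.IsGood d}) := by
    intro v hv
    refine hwf.induction (P := fun v => wordEval S v ∈
      Submodule.span K (wordEval S '' {v' | v'.Perm v ∧ v'.IsGood d})) hv ?_
    intro v hv ih
    by_cases hgood : v.IsGood d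
    · exact Submodule.subset_span ⟨v, ⟨List.Perm.refl v, hgood⟩, rfl⟩
    · rw [List.IsGood] at hgood
      push Not at hgood
      obtain ⟨l, hlv, hl, rfl⟩ := hgood
      obtain ⟨w₀, us, rfl, hus⟩ := hlv.exists_blocks
      have hlen : us.length = l.length := by simpa using congrArg List.length hus
      obtain ⟨u, rfl⟩ : ∃ u : Fin l.length → List (Fin n), us = List.ofFn u := by
        rw [← hlen]
        exact ⟨us.get, (List.ofFn_get us).symm⟩
      have hu : Function.Injective u := by
        have h1 : ∀ i, (u i).head? = some (l.get i) := by
          intro i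
          have := congrArg (fun l => l[(i : ℕ)]?) hus
          simpa using this
        have h2 : Function.Injective l.get := by
          rw [← List.nodup_iff_injective_get]
          exact hl.imp fun h => h.ne'
        intro i j hij
        have := h1 i
        rw [hij, h1 j] at this
        exact h2 (Option.some.inj this).symm
      let f : Equiv.Perm (Fin l.length) → List (Fin n) := fun σ =>
        w₀ ++ (List.ofFn fun i => u (σ i)).flatten
      have hperm : ∀ σ, (f σ).Perm (f 1) := fun σ =>
        List.Perm.append_left w₀ (σ.ofFn_comp_perm u).flatten
      have hlt : ∀ σ, σ ≠ 1 → f σ < f 1 := by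
        intro σ hσ
        refine List.append_left_lt
          (List.flatten_lt_of_perm hus hl (σ.ofFn_comp_perm u) fun h => hσ ?_)
        ext i
        exact congrArg Fin.val (hu (congrFun (List.ofFn_injective h) i))
      -- The identity is evaluated at the values of the blocks, which lie in `S` since `S` is a
      -- submonoid. Solving for the term of `σ = 1` expresses the word through lexicographically
      -- smaller rearrangements.
      have hsum : ∑ σ, α σ • wordEval S (f σ) = 0 := by
        funext x
        have h := hid (fun i => wordEval S (u i) x) fun i => wordEval_mem S _ x
        have h' := congrArg (fun y => wordEval S w₀ x * y) h
        simp only [mul_zero, Finset.mul_sum, mul_smul_comm] at h'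
        rw [Finset.sum_apply, Pi.zero_apply, ← h']
        refine Finset.sum_congr rfl fun σ _ => ?_
        rw [Pi.smul_apply, wordEval_append, wordEval_flatten, List.map_ofFn]
        rfl
      rw [← Finset.add_sum_erase _ _ (Finset.mem_univ 1)] at hsum
      have h1 : wordEval S (f 1) =
          -((α 1)⁻¹ • ∑ σ ∈ Finset.univ.erase 1, α σ • wordEval S (f σ)) := by
        rw [← smul_neg, ← eq_neg_of_add_eq_zero_left hsum, inv_smul_smul₀ hα]
      change wordEval S (f 1) ∈ _
      rw [h1]
      refine Submodule.neg_mem _ (Submodule.smul_mem _ _ (Submodule.sum_mem _ fun σ hσ =>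
        Submodule.smul_mem _ _ ?_))
      refine Submodule.span_mono (Set.image_mono ?_) (ih (f σ) ?_ (hlt σ (Finset.ne_of_mem_erase hσ)))
      · rintro v' ⟨hv', hv''⟩
        exact ⟨hv'.trans (hperm σ), hv''⟩
      · exact (hperm σ).length_eq.trans hv
  exact key w rfl

end Words

/-! ### Counting permutations without long decreasing subsequences. -/

section Count

variable {n d : ℕ}

/-- If `ρ` has no decreasing subsequence of length `d`, then its positions can be coloured with
`d` colours so that `ρ` increases on each colour. -/
theorem exists_coloring (ρ : Equiv.Perm (Fin n)) (h : (List.ofFn ρ).IsGood d) :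
    ∃ c : Fin n → Fin d, ∀ i j, i < j → c i = c j → ρ i < ρ j := by
  classical
  -- The colour `L i` of a position is the length of a longest decreasing subsequence ending there.
  -- If `i < j` and `ρ j < ρ i`, such a subsequence ending at `i` extends to `j`, so the colours
  -- differ.
  let C : Fin n → Finset (Finset (Fin n)) := fun i =>
    {s | i ∈ s ∧ (∀ j ∈ s, j ≤ i) ∧ StrictAntiOn ρ (s : Set (Fin n))}
  let L : Fin n → ℕ := fun i => (C i).sup Finset.card
  have hL : ∀ i, L i < d := by
    intro i
    rcases d.eq_zero_or_pos with rfl | hd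
    · exact absurd rfl (h [] (List.nil_sublist _) List.Pairwise.nil)
    rw [Finset.sup_lt_iff (by simpa using hd)]
    intro s hs
    obtain ⟨-, -, hs⟩ := (Finset.mem_filter.1 hs).2
    by_contra! hcard
    let l := ((List.finRange n).filter (· ∈ s)).map ρ
    have hl1 : l.Sublist (List.ofFn ρ) := by
      rw [List.ofFn_eq_map]
      exact List.filter_sublist.map ρ
    have hl2 : l.Pairwise (· > ·) := by
      rw [List.pairwise_map]
      have h1 : ((List.finRange n).filter (· ∈ s)).Pairwise (· < ·) :=
        List.Pairwise.filter _ (List.pairwise_lt_finRange n)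
      refine h1.imp_of_mem fun ha hb hab => ?_
      exact hs (by simpa using ha) (by simpa using hb) hab
    have hl3 : l.length = s.card := by
      rw [List.length_map, ← List.toFinset_card_of_nodup ((List.nodup_finRange n).filter _)]
      congr 1
      ext x
      simp
    refine h (l.take d) ((List.take_sublist d l).trans hl1) (hl2.sublist (List.take_sublist d l)) ?_
    rw [List.length_take, hl3]
    omega
  refine ⟨fun i => ⟨L i, hL i⟩, fun i j hij hc => ?_⟩
  by_contra! hle
  have hlt : ρ j < ρ i := lt_of_le_of_ne hle fun h => hij.ne' (ρ.injective h)
  have hne : (C i).Nonempty := ⟨{i}, by simp [C]⟩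
  obtain ⟨s, hs, hsL⟩ := Finset.exists_mem_eq_sup (C i) hne Finset.card
  obtain ⟨his, hsi, hanti⟩ := (Finset.mem_filter.1 hs).2
  have hj : j ∉ s := fun h => absurd (hsi j h) (not_le.2 hij)
  have : insert j s ∈ C j := by
    refine Finset.mem_filter.2 ⟨Finset.mem_univ _, Finset.mem_insert_self _ _, ?_, ?_⟩
    · intro a ha
      rcases Finset.mem_insert.1 ha with rfl | ha
      · exact le_rfl
      · exact (hsi a ha).trans hij.le
    · intro a ha b hb hab
      rw [Finset.mem_coe, Finset.mem_insert] at ha hb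
      rcases ha with rfl | ha <;> rcases hb with rfl | hb
      · exact absurd hab (lt_irrefl _)
      · exact absurd (hsi b hb) (not_le.2 (hij.trans hab))
      · exact hlt.trans_le (hanti.antitoneOn ha his (hsi a ha))
      · exact hanti ha hb hab
  have h2 : (insert j s).card ≤ L j := Finset.le_sup (f := Finset.card) this
  rw [Finset.card_insert_of_notMem hj, ← hsL] at h2
  have : L i = L j := congrArg Fin.val hc
  change L i + 1 ≤ L j at h2
  omega

/-- By strong induction `τ` fixes everything below `i`. Then `τ i < i` contradicts injectivity, and
if `τ i > i` the preimage of `i` is a later position of the same colour with a smaller value. -/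
theorem eq_one_of_strictMono_on_colors {γ : Type*} (c : Fin n → γ) (τ : Equiv.Perm (Fin n))
    (hc : ∀ i, c (τ i) = c i) (hτ : ∀ i j, i < j → c i = c j → τ i < τ j) : τ = 1 := by
  ext1 i
  rw [Equiv.Perm.one_apply]
  induction i using WellFoundedLT.induction with
  | ind i ih =>
    rcases lt_trichotomy (τ i) i with h | h | h
    · exact τ.injective (ih _ h)
    · exact h
    · obtain ⟨j, hj⟩ := τ.surjective i
      have hcj : c i = c j := by rw [← hc j, hj]
      rcases lt_trichotomy i j with h' | h' | h'
      · have := hτ i j h' hcj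
        rw [hj] at this
        exact absurd h this.asymm
      · rw [h', hj]
        exact h'
      · have := ih j h'
        rw [hj] at this
        exact absurd this h'.ne'

/-- A good `ρ` is determined by the colours of its positions and of its values. If `ρ` and `ρ'`
share these data, `ρ'⁻¹ρ` preserves colours and increases on each colour class, hence is the
identity. -/
theorem card_isGood_le [DecidablePred fun ρ : Equiv.Perm (Fin n) => (List.ofFn ρ).IsGood d] :
    Fintype.card {ρ : Equiv.Perm (Fin n) // (List.ofFn ρ).IsGood d} ≤ (d * d) ^ n := by
  choose c hc using fun ρ : {ρ : Equiv.Perm (Fin n) // (List.ofFn ρ).IsGood d} =>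
    exists_coloring ρ.1 ρ.2
  have hinj : Function.Injective
      (fun ρ => fun i => (c ρ i, c ρ (ρ.1.symm i)) : _ → Fin n → Fin d × Fin d) := by
    intro ρ ρ' h
    have h1 : ∀ i, c ρ i = c ρ' i := fun i => congrArg Prod.fst (congrFun h i)
    have h2 : ∀ i, c ρ (ρ.1.symm i) = c ρ' (ρ'.1.symm i) := fun i =>
      congrArg Prod.snd (congrFun h i)
    have h3 : ∀ i, c ρ (ρ'.1.symm (ρ.1 i)) = c ρ i := by
      intro i
      have := h2 (ρ.1 i)
      rw [Equiv.symm_apply_apply, ← h1] at this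
      exact this.symm
    have h4 := eq_one_of_strictMono_on_colors (c ρ) (ρ.1.trans ρ'.1.symm) h3 (by
      intro i j hij hcij
      have h5 := hc ρ i j hij hcij
      by_contra! hle
      have hne : ρ'.1.symm (ρ.1 j) ≠ ρ'.1.symm (ρ.1 i) := fun h =>
        hij.ne' (ρ.1.injective (ρ'.1.symm.injective h))
      have h6 := hc ρ' (ρ'.1.symm (ρ.1 j)) (ρ'.1.symm (ρ.1 i)) (lt_of_le_of_ne hle hne)
        (by rw [← h1, ← h1, h3, h3, hcij])
      rw [Equiv.apply_symm_apply, Equiv.apply_symm_apply] at h6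
      exact h5.asymm h6)
    refine Subtype.ext (Equiv.ext fun i => ?_)
    have := Equiv.congr_fun h4 i
    exact (Equiv.symm_apply_eq _).1 this
  simpa using Fintype.card_le_of_injective _ hinj

theorem exists_pow_lt_factorial (c : ℕ) : ∃ n : ℕ, c ^ n < n.factorial := by
  have h := FloorSemiring.tendsto_pow_div_factorial_atTop (c : ℝ)
  obtain ⟨n, hn⟩ := (h.eventually (gt_mem_nhds zero_lt_one)).exists
  refine ⟨n, ?_⟩
  rw [div_lt_one (by positivity)] at hn
  exact_mod_cast hn

end Count

/-! ### Regev's theorem. -/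

section Regev

theorem List.prod_map_mul_of_commute {M β : Type*} [Monoid M] (f g : β → M)
    (h : ∀ i j, Commute (f i) (g j)) (l : List β) :
    (l.map fun i => f i * g i).prod = (l.map f).prod * (l.map g).prod := by
  induction l with
  | nil => simp
  | cons i l ih =>
    have hc : Commute (l.map f).prod (g i) := by
      refine Commute.list_prod_left _ _ fun x hx => ?_
      obtain ⟨j, -, rfl⟩ := List.mem_map.1 hx
      exact h j i
    simp only [List.map_cons, List.prod_cons]
    rw [ih, mul_assoc, mul_assoc, ← mul_assoc (g i), ← hc.eq, mul_assoc]

variable {K X : Type*} [Field K] [Ring X] [Algebra K X]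

/-- A rearrangement of the word of a permutation is again the word of a permutation, so only good
permutations are needed. -/
theorem wordEval_ofFn_mem_span {d : ℕ} (S : Submonoid X) (α : Equiv.Perm (Fin d) → K)
    (hα : α 1 ≠ 0)
    (hid : ∀ z : Fin d → X, (∀ i, z i ∈ S) → ∑ σ, α σ • (List.ofFn fun i => z (σ i)).prod = 0)
    {n : ℕ} (π : Equiv.Perm (Fin n)) :
    wordEval S (List.ofFn π) ∈ Submodule.span K (Set.range
      fun ρ : {ρ : Equiv.Perm (Fin n) // (List.ofFn ρ).IsGood d} => wordEval S (List.ofFn ρ.1)) := by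
  refine Submodule.span_mono ?_ (wordEval_mem_span_isGood S α hα hid (List.ofFn π))
  rintro _ ⟨v, ⟨hv, hgood⟩, rfl⟩
  have hlen : v.length = n := by simpa using hv.length_eq
  obtain ⟨f, rfl⟩ : ∃ f : Fin n → Fin n, v = List.ofFn f := by
    have : ∀ m, v.length = m → ∃ f : Fin m → Fin n, v = List.ofFn f := by
      rintro _ rfl
      exact ⟨v.get, (List.ofFn_get v).symm⟩
    exact this n hlen
  have hf : Function.Injective f := by
    rw [← List.nodup_ofFn, hv.nodup_iff, List.nodup_ofFn]
    exact π.injective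
  exact ⟨⟨Equiv.ofBijective f (Finite.injective_iff_bijective.1 hf), hgood⟩, rfl⟩

/-- If two commuting submonoids satisfy proper multilinear identities and their products span `X`,
then `X` is a polynomial identity algebra. -/
theorem isPIAlgebra_of_span_mul {d₁ d₂ : ℕ} (S₁ S₂ : Submonoid X)
    (hcomm : ∀ a ∈ S₁, ∀ b ∈ S₂, Commute a b)
    (hspan : Submodule.span K (Set.image2 (· * ·) (S₁ : Set X) S₂) = ⊤)
    (α₁ : Equiv.Perm (Fin d₁) → K) (hα₁ : α₁ 1 ≠ 0)
    (h₁ : ∀ z : Fin d₁ → X, (∀ i, z i ∈ S₁) →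
      ∑ σ, α₁ σ • (List.ofFn fun i => z (σ i)).prod = 0)
    (α₂ : Equiv.Perm (Fin d₂) → K) (hα₂ : α₂ 1 ≠ 0)
    (h₂ : ∀ z : Fin d₂ → X, (∀ i, z i ∈ S₂) →
      ∑ σ, α₂ σ • (List.ofFn fun i => z (σ i)).prod = 0) : IsPIAlgebra K X := by
  classical
  -- The base bounds the number of pairs of good permutations by an `n`-th power, which `n!`
  -- eventually exceeds.
  obtain ⟨n, hn⟩ := exists_pow_lt_factorial ((d₁ * d₁) * (d₂ * d₂))
  let V₁ := (Fin n → S₁) → X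
  let V₂ := (Fin n → S₂) → X
  let T := (Fin n → S₁) × (Fin n → S₂) → X
  let β : V₁ →ₗ[K] V₂ →ₗ[K] T := LinearMap.mk₂ K (fun f g p => f p.1 * g p.2)
    (fun f f' g => funext fun p => add_mul _ _ _)
    (fun c f g => funext fun p => smul_mul_assoc _ _ _)
    (fun f g g' => funext fun p => mul_add _ _ _)
    (fun c f g => funext fun p => mul_smul_comm _ _ _)
  let Q := {ρ : Equiv.Perm (Fin n) // (List.ofFn ρ).IsGood d₁} ×
    {ρ : Equiv.Perm (Fin n) // (List.ofFn ρ).IsGood d₂}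
  let q : Q → T := fun p =>
    β (wordEval S₁ (List.ofFn p.1.1)) (wordEval S₂ (List.ofFn p.2.1))
  let P : Equiv.Perm (Fin n) → T := fun π =>
    β (wordEval S₁ (List.ofFn π)) (wordEval S₂ (List.ofFn π))
  have hP : Set.range P ≤ Submodule.span K (Set.range q) := by
    rintro _ ⟨π, rfl⟩
    have := Submodule.apply_mem_map₂ β (wordEval_ofFn_mem_span S₁ α₁ hα₁ h₁ π)
      (wordEval_ofFn_mem_span S₂ α₂ hα₂ h₂ π)
    rw [Submodule.map₂_span_span] at this
    refine Submodule.span_mono ?_ this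
    rintro _ ⟨_, ⟨ρ, rfl⟩, _, ⟨ρ', rfl⟩, rfl⟩
    exact ⟨(ρ, ρ'), rfl⟩
  -- The `n!` functions `P π` lie in a span of fewer than `n!` functions. A relation among them will
  -- give the coefficients of the identity.
  have hdep : ¬ LinearIndependent K P := by
    intro hli
    have h3 := linearIndependent_le_span_aux' P hli (Set.range q) hP
    have h4 : Fintype.card (Set.range q) ≤ Fintype.card Q :=
      Fintype.card_le_of_surjective _ Set.rangeFactorization_surjective
    have h5 : Fintype.card Q ≤ (d₁ * d₁) ^ n * (d₂ * d₂) ^ n := by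
      rw [Fintype.card_prod]
      exact Nat.mul_le_mul card_isGood_le card_isGood_le
    rw [Fintype.card_perm, Fintype.card_fin] at h3
    rw [mul_pow] at hn
    omega
  obtain ⟨γ, hγ, hγ0⟩ := Fintype.not_linearIndependent_iff.1 hdep
  refine isPIAlgebra_of_multilinear γ hγ0 fun z => ?_
  let M : MultilinearMap K (fun _ : Fin n => X) X :=
    ∑ π : Equiv.Perm (Fin n), γ π • (MultilinearMap.mkPiAlgebraFin K n X).domDomCongr π
  have hM : ∀ z, M z = ∑ π, γ π • (List.ofFn fun i => z (π i)).prod := by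
    intro z
    simp [M]
  have hM0 : M = 0 := by
    -- By multilinearity it suffices to test on a basis drawn from the products `a * b`. There each
    -- monomial separates into a word in the `a`'s times the same word in the `b`'s, which is a
    -- value of `P π`.
    refine Module.Basis.ext_multilinear (fun _ => Module.Basis.ofSpan hspan.ge) fun v => ?_
    have hmem : ∀ i, ∃ a : S₁, ∃ b : S₂, (a : X) * b = Module.Basis.ofSpan hspan.ge (v i) := by
      intro i
      obtain ⟨a, ha, b, hb, hab⟩ := Module.Basis.ofSpan_subset hspan.ge ⟨v i, rfl⟩
      exact ⟨⟨a, ha⟩, ⟨b, hb⟩, hab⟩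
    choose a b hab using hmem
    rw [hM, zero_apply]
    have h0 := congrFun hγ (a, b)
    rw [Finset.sum_apply] at h0
    rw [← Pi.zero_apply (M := fun _ => X) ((a, b) : (Fin n → S₁) × (Fin n → S₂)), ← h0]
    refine Finset.sum_congr rfl fun π _ => ?_
    rw [Pi.smul_apply]
    congr 1
    change _ = wordEval S₁ (List.ofFn π) a * wordEval S₂ (List.ofFn π) b
    rw [wordEval, wordEval, ← List.prod_map_mul_of_commute _ _
      (fun i j => hcomm _ (a i).2 _ (b j).2), List.map_ofFn]
    simp only [← hab]
    rfl
  rw [← hM, hM0, zero_apply]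

/-- Regev's theorem: an algebra spanned by products of elements of two commuting polynomial
identity algebras is a polynomial identity algebra. -/
theorem IsCommProduct.isPIAlgebra {K₁ K₂ G₁ G₂ : Type*} [Field K₁] [Field K₂] [Ring G₁] [Ring G₂]
    [Algebra K₁ G₁] [Algebra K₂ G₂] [Algebra K₁ K] [Algebra K₂ K] [Algebra K₁ X] [Algebra K₂ X]
    [IsScalarTower K₁ K X] [IsScalarTower K₂ K X] {α₁ : G₁ →ₐ[K₁] X} {α₂ : G₂ →ₐ[K₂] X}
    (h : IsCommProduct K α₁ α₂) (h₁ : IsPIAlgebra K₁ G₁) (h₂ : IsPIAlgebra K₂ G₂) :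
    IsPIAlgebra K X := by
  obtain ⟨d₁, c₁, hc₁, hid₁⟩ := h₁.exists_multilinear
  obtain ⟨d₂, c₂, hc₂, hid₂⟩ := h₂.exists_multilinear
  refine isPIAlgebra_of_span_mul (MonoidHom.mrange (α₁ : G₁ →* X)) (MonoidHom.mrange (α₂ : G₂ →* X))
    ?_ ?_ (fun σ => algebraMap K₁ K (c₁ σ)) (by simpa using hc₁) ?_
    (fun σ => algebraMap K₂ K (c₂ σ)) (by simpa using hc₂) ?_
  · rintro _ ⟨a, rfl⟩ _ ⟨b, rfl⟩
    exact h.commute a b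
  · rw [← h.span_eq_top]
    congr 1
    ext x
    constructor
    · rintro ⟨_, ⟨a, rfl⟩, _, ⟨b, rfl⟩, rfl⟩
      exact ⟨a, trivial, b, trivial, rfl⟩
    · rintro ⟨a, -, b, -, rfl⟩
      exact ⟨_, ⟨a, rfl⟩, _, ⟨b, rfl⟩, rfl⟩
  · intro z hz
    choose y hy using hz
    rw [← map_zero α₁, ← hid₁ y, map_sum]
    refine Finset.sum_congr rfl fun σ _ => ?_
    rw [algebraMap_smul, map_smul, map_list_prod, List.map_ofFn]
    simp only [← hy]
    rfl
  · intro z hz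
    choose y hy using hz
    rw [← map_zero α₂, ← hid₂ y, map_sum]
    refine Finset.sum_congr rfl fun σ _ => ?_
    rw [algebraMap_smul, map_smul, map_list_prod, List.map_ofFn]
    simp only [← hy]
    rfl

end Regev

/-! ### Base change of commuting products. -/

section BaseChange

variable {D D₁ D₂ G₁ G₂ X C : Type*} [CommRing D] [CommRing D₁] [CommRing D₂]
  [Ring G₁] [Ring G₂] [Ring X] [Algebra D₁ G₁] [Algebra D₂ G₂] [Algebra D X]
  [Algebra D₁ X] [Algebra D₂ X] [Algebra D₁ D] [Algebra D₂ D] [IsScalarTower D₁ D X]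
  [IsScalarTower D₂ D X] [CommRing C] [Algebra D C] [Algebra D₁ C] [Algebra D₂ C]
  [IsScalarTower D₁ D C] [IsScalarTower D₂ D C] {α₁ : G₁ →ₐ[D₁] X} {α₂ : G₂ →ₐ[D₂] X}

theorem span_range_includeRight :
    Submodule.span C (Set.range (Algebra.TensorProduct.includeRight : X →ₐ[D] C ⊗[D] X)) = ⊤ := by
  rw [eq_top_iff]
  rintro x -
  induction x using TensorProduct.induction_on with
  | zero => exact Submodule.zero_mem _
  | add x y hx hy => exact Submodule.add_mem _ hx hy
  | tmul c x =>
    have : c ⊗ₜ[D] x = c • (1 ⊗ₜ[D] x : C ⊗[D] X) := by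
      rw [TensorProduct.smul_tmul', smul_eq_mul, mul_one]
    rw [this]
    exact Submodule.smul_mem _ _ (Submodule.subset_span ⟨x, rfl⟩)

theorem IsCommProduct.baseChange (h : IsCommProduct D α₁ α₂) :
    IsCommProduct C
      (((Algebra.TensorProduct.includeRight : X →ₐ[D] C ⊗[D] X).restrictScalars D₁).comp α₁)
      (((Algebra.TensorProduct.includeRight : X →ₐ[D] C ⊗[D] X).restrictScalars D₂).comp α₂) :=
  h.comp _ span_range_includeRight

end BaseChange

/-! ### Reduction to finite fields. -/

section Reduction

/-- The image of a commutative ring in a finite field is a finite field. -/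
theorem exists_finite_field_factor (D K : Type u) [CommRing D] [Field K] [Finite K] [Algebra D K] :
    ∃ (L : Type u) (_ : Field L) (_ : Finite L) (_ : Algebra D L) (_ : Algebra L K),
      IsScalarTower D L K ∧ Function.Surjective (algebraMap D L) := by
  let I := RingHom.ker (algebraMap D K)
  have hfin : Finite (D ⧸ I) :=
    Finite.of_injective _ (RingHom.kerLift_injective (algebraMap D K))
  have hI : I.IsPrime := RingHom.ker_isPrime _
  have hmax : I.IsMaximal :=
    Ideal.Quotient.maximal_of_isField I (Finite.isDomain_to_isField (D ⧸ I))
  let := Ideal.Quotient.field I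
  let : Algebra (D ⧸ I) K := (RingHom.kerLift (algebraMap D K)).toAlgebra
  exact ⟨D ⧸ I, inferInstance, hfin, inferInstance, inferInstance,
    IsScalarTower.of_algebraMap_eq fun _ => rfl, Ideal.Quotient.mk_surjective⟩

variable {D₁ D₂ G₁ G₂ X K : Type u} [CommRing D₁] [CommRing D₂]
  [Ring G₁] [Ring G₂] [Ring X] [Algebra D₁ G₁] [Algebra D₂ G₂]
  [Algebra D₁ X] [Algebra D₂ X] [Field K] [Finite K] [Algebra K X] [Algebra D₁ K] [Algebra D₂ K]
  [IsScalarTower D₁ K X] [IsScalarTower D₂ K X] {α₁ : G₁ →ₐ[D₁] X} {α₂ : G₂ →ₐ[D₂] X}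

/-- `K` need not be a factor ring of `D₁` or `D₂`, but the images of these rings in `K` are finite
fields `L₁` and `L₂` to which `h₁` and `h₂` apply. The products from `L₁ ⊗ G₁` and `L₂ ⊗ G₂` still
span `X` over `K`. -/
theorem IsCommProduct.finiteType_and_isPIAlgebra (h : IsCommProduct K α₁ α₂)
    (h₁ : ∀ (L : Type u) [Field L] [Finite L] [Algebra D₁ L],
      Function.Surjective (algebraMap D₁ L) →
        Algebra.FiniteType L (L ⊗[D₁] G₁) ∧ IsPIAlgebra L (L ⊗[D₁] G₁))
    (h₂ : ∀ (L : Type u) [Field L] [Finite L] [Algebra D₂ L],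
      Function.Surjective (algebraMap D₂ L) →
        Algebra.FiniteType L (L ⊗[D₂] G₂) ∧ IsPIAlgebra L (L ⊗[D₂] G₂)) :
    Algebra.FiniteType K X ∧ IsPIAlgebra K X := by
  obtain ⟨L₁, _, _, _, _, _, hL₁⟩ := exists_finite_field_factor D₁ K
  obtain ⟨L₂, _, _, _, _, _, hL₂⟩ := exists_finite_field_factor D₂ K
  let : Algebra L₁ X := Algebra.compHom X (algebraMap L₁ K)
  let : Algebra L₂ X := Algebra.compHom X (algebraMap L₂ K)
  have : IsScalarTower L₁ K X := IsScalarTower.of_algebraMap_eq fun _ => rfl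
  have : IsScalarTower L₂ K X := IsScalarTower.of_algebraMap_eq fun _ => rfl
  have : IsScalarTower D₁ L₁ X := IsScalarTower.of_algebraMap_eq fun x => by
    rw [IsScalarTower.algebraMap_apply L₁ K X, ← IsScalarTower.algebraMap_apply D₁ L₁ K,
      ← IsScalarTower.algebraMap_apply D₁ K X]
  have : IsScalarTower D₂ L₂ X := IsScalarTower.of_algebraMap_eq fun x => by
    rw [IsScalarTower.algebraMap_apply L₂ K X, ← IsScalarTower.algebraMap_apply D₂ L₂ K,
      ← IsScalarTower.algebraMap_apply D₂ K X]
  have h' := h.lift (K₁ := L₁) (K₂ := L₂)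
  exact ⟨h'.finiteType (h₁ L₁ hL₁).1 (h₂ L₂ hL₂).1, h'.isPIAlgebra (h₁ L₁ hL₁).2 (h₂ L₂ hL₂).2⟩

end Reduction

namespace AlgFiltration

/-! ### Noetherian properties of product filtrations. -/

section Noetherian

variable {R S₁ S₂ G₁ G₂ X : Type u} [CommRing R] [CommRing S₁]
  [CommRing S₂] [Ring G₁] [Ring G₂] [Ring X] [Algebra S₁ G₁] [Algebra S₂ G₂] [Algebra R X]
  [Algebra S₁ X] [Algebra S₂ X] [Algebra S₁ R] [Algebra S₂ R] [IsScalarTower S₁ R X]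
  [IsScalarTower S₂ R X] {α₁ : G₁ →ₐ[S₁] X} {α₂ : G₂ →ₐ[S₂] X}

theorem isNoethRing_of_isCommProduct (F₁ : AlgFiltration S₁ G₁) (F₂ : AlgFiltration S₂ G₂)
    (h : IsCommProduct R α₁ α₂) (hR : IsNoetherianRing R)
    (h₁ : IsUniversallyNoetherian S₁ F₁.Gr) (h₂ : IsStronglyNoetherian S₂ F₂.Gr) :
    IsNoethRing X := by
  obtain ⟨F, hF⟩ := exists_isProduct F₁ F₂ h
  exact F.isNoethRing_of_gr ((hF.gr h.commute).isNoethRing hR h₁ h₂)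

theorem IsProduct.isStronglyNoetherian_gr {F₁ : AlgFiltration S₁ G₁} {F₂ : AlgFiltration S₂ G₂}
    {F : AlgFiltration R X} (hF : IsProduct F₁ F₂ F α₁ α₂) (hc : ∀ a b, Commute (α₁ a) (α₂ b))
    (h₁ : IsUniversallyNoetherian S₁ F₁.Gr) (h₂ : IsStronglyNoetherian S₂ F₂.Gr) :
    IsStronglyNoetherian R F.Gr := by
  intro C _ _ hC
  let : Algebra S₁ C := Algebra.compHom C (algebraMap S₁ R)
  let : Algebra S₂ C := Algebra.compHom C (algebraMap S₂ R)
  have : IsScalarTower S₁ R C := IsScalarTower.of_algebraMap_eq fun _ => rfl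
  have : IsScalarTower S₂ R C := IsScalarTower.of_algebraMap_eq fun _ => rfl
  have h := ((hF.gr hc).baseChange (C := C)).isNoethRing hC h₁ h₂
  exact h.of_surjective (Algebra.TensorProduct.comm R C F.Gr).toAlgHom.toRingHom
    (Algebra.TensorProduct.comm R C F.Gr).surjective

end Noetherian

/-! ### The induced filtration on the product order. -/

section InducedProduct

variable {k D D₁ D₂ A₁ A₂ A : Type*} [Field k] [CommRing D] [CommRing D₁] [CommRing D₂]
  [Algebra D k] [Algebra D₁ k] [Algebra D₂ k] [Algebra D₁ D] [Algebra D₂ D]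
  [Ring A₁] [Ring A₂] [Ring A] [Algebra k A₁] [Algebra k A₂] [Algebra k A]
  [Algebra D₁ A₁] [Algebra D₂ A₂] [Algebra D A] [Algebra D₁ A] [Algebra D₂ A]
  [IsScalarTower D₁ k A₁] [IsScalarTower D₂ k A₂] [IsScalarTower D k A]
  [IsScalarTower D₁ D A] [IsScalarTower D₂ D A]
  {B₁ : Subalgebra D₁ A₁} {B₂ : Subalgebra D₂ A₂} {B : Subalgebra D A}
  {F₁ : AlgFiltration k A₁} {F₂ : AlgFiltration k A₂} {F : AlgFiltration k A}
  {j₁ : A₁ →ₐ[k] A} {j₂ : A₂ →ₐ[k] A} {i₁ : B₁ →ₐ[D₁] B} {i₂ : B₂ →ₐ[D₂] B}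

/-- The filtration `M` is left general so that the result can be used twice: for the abstract
product filtration, where injectivity of `f` identifies it with the induced one, and then for the
induced filtration with `grIncl`. -/
theorem IsProduct.isOrder_gr (hDk : Function.Injective (algebraMap D k))
    (hF : IsProduct F₁ F₂ F j₁ j₂) (hc : ∀ a b, Commute (j₁ a) (j₂ b))
    (hbij : Function.Bijective (Algebra.TensorProduct.lift j₁ j₂ hc))
    (hi₁ : ∀ b, (i₁ b : A) = j₁ b) (hi₂ : ∀ b, (i₂ b : A) = j₂ b)
    (h₁ : IsOrder k (F₁.grIncl B₁)) (h₂ : IsOrder k (F₂.grIncl B₂))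
    {M : AlgFiltration D B} (hM : IsProduct (F₁.induced B₁) (F₂.induced B₂) M i₁ i₂)
    (hi : ∀ a b, Commute (i₁ a) (i₂ b)) (hMF : ∀ n, ∀ b ∈ M.toFun n, (b : A) ∈ F.toFun n)
    (f : M.Gr →ₐ[D] F.Gr) (hf : ∀ n b, f (M.cls n b) = F.cls n ⟨b, hMF n b b.2⟩) :
    IsOrder k f := by
  refine (hM.gr hi).isOrder hDk h₁ h₂ _ _ _ (hF.bijective_gr hc hbij) f (fun v => ?_) fun v => ?_
  · induction v using (F₁.induced B₁).gr_induction with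
    | h0 => simp only [map_zero]
    | hadd x y hx hy => simp only [map_add, hx, hy]
    | hcls n b =>
      rw [grMap_cls, hf, grIncl_cls, grMap_cls]
      exact F.cls_congr rfl (hi₁ b)
  · induction v using (F₂.induced B₂).gr_induction with
    | h0 => simp only [map_zero]
    | hadd x y hx hy => simp only [map_add, hx, hy]
    | hcls n b =>
      rw [grMap_cls, hf, grIncl_cls, grMap_cls]
      exact F.cls_congr rfl (hi₂ b)

/-- The filtration induced on the order generated by two orders is again a product filtration. -/
theorem IsProduct.induced (hDk : Function.Injective (algebraMap D k))
    (hF : IsProduct F₁ F₂ F j₁ j₂) (hc : ∀ a b, Commute (j₁ a) (j₂ b))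
    (hbij : Function.Bijective (Algebra.TensorProduct.lift j₁ j₂ hc))
    (hi₁ : ∀ b, (i₁ b : A) = j₁ b) (hi₂ : ∀ b, (i₂ b : A) = j₂ b)
    (h₁ : IsOrder k (F₁.grIncl B₁)) (h₂ : IsOrder k (F₂.grIncl B₂))
    (hi : IsCommProduct D i₁ i₂) :
    IsProduct (F₁.induced B₁) (F₂.induced B₂) (F.induced B) i₁ i₂ := by
  obtain ⟨M, hM⟩ := exists_isProduct (F₁.induced B₁) (F₂.induced B₂) hi
  have hMF : ∀ n, M.toFun n ≤ (F.induced B).toFun n := by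
    intro n
    rw [hM n, Submodule.span_le]
    rintro _ ⟨r, s, hrs, a, ha, b, hb, rfl⟩
    change ((i₁ a * i₂ b : B) : A) ∈ F.toFun n
    rw [Subalgebra.coe_mul, hi₁, hi₂]
    exact hF.mul_mem hrs ha hb
  have hMF' : ∀ n, ∀ b ∈ M.toFun n, B.val b ∈ F.toFun n := fun n b hb => hMF n hb
  have hinj := (hF.isOrder_gr hDk hc hbij hi₁ hi₂ h₁ h₂ hM hi.commute hMF
    (M.grMap F B.val hMF') (M.grMap_cls F B.val hMF')).injective
  -- Injectivity on graded pieces means strictness: an element of layer `n` of `M` that drops in `F`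
  -- also drops in `M`. Starting from any layer of `M` that contains `b`, repeated drops lead down
  -- to layer `n`.
  have hpred : ∀ n, ∀ b ∈ M.toFun n, (b : A) ∈ F.pred n → b ∈ M.pred n := by
    intro n b hb hbF
    rw [← M.cls_eq_zero_iff (a := ⟨b, hb⟩)]
    apply hinj
    rw [map_zero, grMap_cls, cls_eq_zero_iff]
    exact hbF
  have hle : ∀ n, (F.induced B).toFun n ≤ M.toFun n := by
    intro n b hb
    obtain ⟨m, hm⟩ := M.exhaustive' b
    induction m with
    | zero => exact M.mono' n.zero_le hm
    | succ m ih =>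
      rcases le_or_gt (m + 1) n with h | h
      · exact M.mono' h hm
      · exact ih (hpred (m + 1) b hm (F.toFun_le_pred h hb))
  rw [ext_toFun fun n => le_antisymm (hle n) (hMF n)]
  exact hM

end InducedProduct

/-- Noetherianity is not deduced from the reductions of the factors: the filtrations of `G₁` and
`G₂` induce a product filtration on `K ⊗[D] X` whose associated graded ring is noetherian. -/
theorem _root_.IsCommProduct.reduction {D D₁ D₂ G₁ G₂ X : Type u} [CommRing D] [CommRing D₁]
    [CommRing D₂] [Ring G₁] [Ring G₂] [Ring X] [Algebra D₁ G₁] [Algebra D₂ G₂] [Algebra D X]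
    [Algebra D₁ X] [Algebra D₂ X] [Algebra D₁ D] [Algebra D₂ D] [IsScalarTower D₁ D X]
    [IsScalarTower D₂ D X] {α₁ : G₁ →ₐ[D₁] X} {α₂ : G₂ →ₐ[D₂] X} (h : IsCommProduct D α₁ α₂)
    (F₁ : AlgFiltration D₁ G₁) (F₂ : AlgFiltration D₂ G₂)
    (hF₁ : IsUniversallyNoetherian D₁ F₁.Gr) (hF₂ : IsStronglyNoetherian D₂ F₂.Gr)
    (h₁ : ∀ (L : Type u) [Field L] [Finite L] [Algebra D₁ L],
      Function.Surjective (algebraMap D₁ L) →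
        Algebra.FiniteType L (L ⊗[D₁] G₁) ∧ IsPIAlgebra L (L ⊗[D₁] G₁))
    (h₂ : ∀ (L : Type u) [Field L] [Finite L] [Algebra D₂ L],
      Function.Surjective (algebraMap D₂ L) →
        Algebra.FiniteType L (L ⊗[D₂] G₂) ∧ IsPIAlgebra L (L ⊗[D₂] G₂))
    (K : Type u) [Field K] [Finite K] [Algebra D K] :
    Algebra.FiniteType K (K ⊗[D] X) ∧ IsNoethRing (K ⊗[D] X) ∧ IsPIAlgebra K (K ⊗[D] X) := by
  let : Algebra D₁ K := Algebra.compHom K (algebraMap D₁ D)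
  let : Algebra D₂ K := Algebra.compHom K (algebraMap D₂ D)
  have : IsScalarTower D₁ D K := IsScalarTower.of_algebraMap_eq fun _ => rfl
  have : IsScalarTower D₂ D K := IsScalarTower.of_algebraMap_eq fun _ => rfl
  have hK := h.baseChange (C := K)
  obtain ⟨hft, hpi⟩ := hK.finiteType_and_isPIAlgebra h₁ h₂
  exact ⟨hft, AlgFiltration.isNoethRing_of_isCommProduct F₁ F₂ hK inferInstance hF₁ hF₂, hpi⟩

/-! ### Congeniality of the product. -/

section Congenial

variable {k A₁ A₂ A : Type u} [Field k] [Ring A₁] [Ring A₂] [Ring A] [Algebra k A₁] [Algebra k A₂]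
  [Algebra k A] {F₁ : AlgFiltration k A₁} {F₂ : AlgFiltration k A₂} {F : AlgFiltration k A}
  {j₁ : A₁ →ₐ[k] A} {j₂ : A₂ →ₐ[k] A}

/-- The tensor product of two congenial algebras is congenial if the associated graded algebra of
one of the orders is universally noetherian. -/
theorem IsProduct.isCongenialWith {D D₁ D₂ : Subalgebra ℤ k} [Algebra D₁ D] [Algebra D₂ D]
    [IsScalarTower D₁ D A] [IsScalarTower D₂ D A]
    {B₁ : Subalgebra D₁ A₁} {B₂ : Subalgebra D₂ A₂} {B : Subalgebra D A}
    {i₁ : B₁ →ₐ[D₁] B} {i₂ : B₂ →ₐ[D₂] B} (hD : D.FG)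
    (hF : IsProduct F₁ F₂ F j₁ j₂) (hc : ∀ a b, Commute (j₁ a) (j₂ b))
    (hbij : Function.Bijective (Algebra.TensorProduct.lift j₁ j₂ hc))
    (hi₁ : ∀ b, (i₁ b : A) = j₁ b) (hi₂ : ∀ b, (i₂ b : A) = j₂ b) (hi : IsCommProduct D i₁ i₂)
    (h₁ : F₁.IsCongenialWith D₁ B₁) (h₂ : F₂.IsCongenialWith D₂ B₂)
    (huniv : IsUniversallyNoetherian D₁ (F₁.induced B₁).Gr) : F.IsCongenialWith D B := by
  have hDk : Function.Injective (algebraMap D k) := Subtype.val_injective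
  have hB := hF.induced hDk hc hbij hi₁ hi₂ h₁.gr_order h₂.gr_order hi
  have hlf := hB.locallyFinite h₁.order_locallyFinite h₂.order_locallyFinite
  have hlfk := hF.locallyFinite h₁.locallyFinite h₂.locallyFinite
  have hord := hi.isOrder hDk h₁.order h₂.order j₁ j₂ hc hbij B.val hi₁ hi₂
  have hgr := hF.isOrder_gr hDk hc hbij hi₁ hi₂ h₁.gr_order h₂.gr_order hB hi.commute
    (fun _ _ h => h) (F.grIncl B) fun n b => F.grIncl_cls B n b
  have hsn := hB.isStronglyNoetherian_gr hi.commute huniv h₂.gr_stronglyNoetherian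
  refine ⟨hD, hlfk, hord, hlf, hgr, hsn, hlf.gr, ?_⟩
  intro K _ _ _ _
  exact hi.reduction (F₁.induced B₁) (F₂.induced B₂) huniv h₂.gr_stronglyNoetherian
    (fun L _ _ _ hL => ⟨(h₁.reduction L hL).1, (h₁.reduction L hL).2.2⟩)
    (fun L _ _ _ hL => ⟨(h₂.reduction L hL).1, (h₂.reduction L hL).2.2⟩) K

/-- The subalgebra over `D` spanned by the products of elements of `B₁` and `B₂`. -/
theorem exists_order_of_span_mul {k D D₁ D₂ A₁ A₂ A : Type*} [Field k] [CommRing D] [CommRing D₁]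
    [CommRing D₂] [Algebra D₁ k] [Algebra D₂ k] [Algebra D₁ D] [Algebra D₂ D]
    [Ring A₁] [Ring A₂] [Ring A] [Algebra k A₁] [Algebra k A₂] [Algebra k A]
    [Algebra D₁ A₁] [Algebra D₂ A₂] [Algebra D A] [Algebra D₁ A] [Algebra D₂ A]
    [IsScalarTower D₁ k A₁] [IsScalarTower D₂ k A₂] [IsScalarTower D₁ k A]
    [IsScalarTower D₂ k A] [IsScalarTower D₁ D A] [IsScalarTower D₂ D A]
    (j₁ : A₁ →ₐ[k] A) (j₂ : A₂ →ₐ[k] A) (hc : ∀ a b, Commute (j₁ a) (j₂ b))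
    (B₁ : Subalgebra D₁ A₁) (B₂ : Subalgebra D₂ A₂) :
    ∃ (B : Subalgebra D A) (i₁ : B₁ →ₐ[D₁] B) (i₂ : B₂ →ₐ[D₂] B),
      (∀ b, (i₁ b : A) = j₁ b) ∧ (∀ b, (i₂ b : A) = j₂ b) ∧ IsCommProduct D i₁ i₂ := by
  set P := Submodule.span D (Set.image2 (fun a b => j₁ a * j₂ b) (B₁ : Set A₁) (B₂ : Set A₂))
    with hP
  have hmem : ∀ a ∈ B₁, ∀ b ∈ B₂, j₁ a * j₂ b ∈ P := fun a ha b hb =>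
    Submodule.subset_span ⟨a, ha, b, hb, rfl⟩
  let B : Subalgebra D A := P.toSubalgebra
    (by simpa using hmem 1 B₁.one_mem 1 B₂.one_mem)
    (by
      intro x y hx hy
      have h := Submodule.mul_mem_mul hx hy
      rw [hP, Submodule.span_mul_span] at h
      refine Submodule.span_mono ?_ h
      rintro _ ⟨_, ⟨a, ha, b, hb, rfl⟩, _, ⟨a', ha', b', hb', rfl⟩, rfl⟩
      refine ⟨a * a', B₁.mul_mem ha ha', b * b', B₂.mul_mem hb hb', ?_⟩
      change j₁ (a * a') * j₂ (b * b') = _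
      rw [map_mul, map_mul]
      exact ((hc a' b).symm.mul_mul_mul_comm _ _).symm)
  have hB₁ : ∀ b : B₁, j₁ b ∈ B := fun b => by
    have h := hmem b b.2 1 B₂.one_mem
    rwa [map_one, mul_one] at h
  have hB₂ : ∀ b : B₂, j₂ b ∈ B := fun b => by
    have h := hmem 1 B₁.one_mem b b.2
    rwa [map_one, one_mul] at h
  let i₁ : B₁ →ₐ[D₁] B :=
    { toFun := fun b => ⟨j₁ b, hB₁ b⟩
      map_one' := Subtype.ext (map_one j₁)
      map_mul' := fun a b => Subtype.ext (map_mul j₁ (a : A₁) b)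
      map_zero' := Subtype.ext (map_zero j₁)
      map_add' := fun a b => Subtype.ext (map_add j₁ (a : A₁) b)
      commutes' := fun r => Subtype.ext ((j₁.restrictScalars D₁).commutes r) }
  let i₂ : B₂ →ₐ[D₂] B :=
    { toFun := fun b => ⟨j₂ b, hB₂ b⟩
      map_one' := Subtype.ext (map_one j₂)
      map_mul' := fun a b => Subtype.ext (map_mul j₂ (a : A₂) b)
      map_zero' := Subtype.ext (map_zero j₂)
      map_add' := fun a b => Subtype.ext (map_add j₂ (a : A₂) b)
      commutes' := fun r => Subtype.ext ((j₂.restrictScalars D₂).commutes r) }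
  refine ⟨B, i₁, i₂, fun _ => rfl, fun _ => rfl, fun a b => Subtype.ext (hc a b), ?_⟩
  rw [eq_top_iff]
  rintro ⟨x, hx⟩ -
  have key : P ≤ (Submodule.span D
      (Set.image2 (fun a b => i₁ a * i₂ b) Set.univ Set.univ)).map B.val.toLinearMap := by
    rw [hP, Submodule.span_le]
    rintro _ ⟨a, ha, b, hb, rfl⟩
    exact ⟨i₁ ⟨a, ha⟩ * i₂ ⟨b, hb⟩, Submodule.subset_span ⟨_, trivial, _, trivial, rfl⟩, rfl⟩
  obtain ⟨y, hy, hyx⟩ := key hx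
  rw [show (⟨x, hx⟩ : B) = y from Subtype.ext hyx.symm]
  exact hy

/-- The join `D₁ ⊔ D₂` is a common base for both orders, and it is again finitely generated. -/
theorem IsProduct.isCongenial {D₁ D₂ : Subalgebra ℤ k} {B₁ : Subalgebra D₁ A₁}
    {B₂ : Subalgebra D₂ A₂} (hF : IsProduct F₁ F₂ F j₁ j₂) (hc : ∀ a b, Commute (j₁ a) (j₂ b))
    (hbij : Function.Bijective (Algebra.TensorProduct.lift j₁ j₂ hc))
    (h₁ : F₁.IsCongenialWith D₁ B₁) (h₂ : F₂.IsCongenialWith D₂ B₂)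
    (huniv : IsUniversallyNoetherian D₁ (F₁.induced B₁).Gr) : F.IsCongenial := by
  let : Algebra D₁ ↥(D₁ ⊔ D₂) := (Subalgebra.inclusion le_sup_left).toRingHom.toAlgebra
  let : Algebra D₂ ↥(D₁ ⊔ D₂) := (Subalgebra.inclusion le_sup_right).toRingHom.toAlgebra
  have : IsScalarTower D₁ ↥(D₁ ⊔ D₂) A := IsScalarTower.of_algebraMap_eq fun _ => rfl
  have : IsScalarTower D₂ ↥(D₁ ⊔ D₂) A := IsScalarTower.of_algebraMap_eq fun _ => rfl
  obtain ⟨B, i₁, i₂, hi₁, hi₂, hi⟩ := exists_order_of_span_mul (D := ↥(D₁ ⊔ D₂)) j₁ j₂ hc B₁ B₂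
  exact ⟨D₁ ⊔ D₂, B, hF.isCongenialWith (h₁.affine.sup h₂.affine) hc hbij hi₁ hi₂ hi h₁ h₂ huniv⟩

end Congenial

end AlgFiltration

theorem mainTheorem3 {k A₁ A₂ : Type u} [Field k] [Ring A₁] [Ring A₂] [Algebra k A₁] [Algebra k A₂]
    (F₁ : AlgFiltration k A₁) (F₂ : AlgFiltration k A₂)
    (D₁ : Subalgebra ℤ k) (B₁ : Subalgebra D₁ A₁)
    (h₁ : F₁.IsCongenialWith D₁ B₁)
    (huniv : IsUniversallyNoetherian D₁ (F₁.induced B₁).Gr)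
    (h₂ : F₂.IsCongenial) :
    (F₁.tensor F₂).IsCongenial := by
  obtain ⟨D₂, B₂, h₂⟩ := h₂
  refine AlgFiltration.IsProduct.isCongenial (F₁ := F₁) (F₂ := F₂)
    (j₁ := Algebra.TensorProduct.includeLeft) (j₂ := Algebra.TensorProduct.includeRight)
    (fun n => ?_) (fun a b => ?_) ?_ h₁ h₂ huniv
  · change Submodule.span k _ = Submodule.span k _
    simp only [Algebra.TensorProduct.includeLeft_apply, Algebra.TensorProduct.includeRight_apply,
      Algebra.TensorProduct.tmul_mul_tmul, mul_one, one_mul]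
  · simp [Commute, SemiconjBy]
  · rw [Algebra.TensorProduct.lift_includeLeft_includeRight]
    exact Function.bijective_id
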